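/- Let $n\ge 3$ and let $M$ be an open (i.e. non-compact, without boundary) smooth $n$-manifold, Hausdorff and second countable, with a Riemannian metric $g$ of class $C^2$. Let $u_i:M\to\mathbb R$ ($i\in\mathbb N$) be positive functions of class $C^2$. Assume that there is a compact set $K\subset M$ such that $u_i=1$ on $M\setminus K$ for every $i$, and that $u_i\to 1$ uniformly on $M$ in the $C^1$-sense, that is, $$\sup_M|u_i-1|\longrightarrow 0\quad\text{and}\quad \sup_M|du_i|_g\longrightarrow 0\qquad (i\to\infty).$$ Put $g_i:=u_i^{\frac{4}{n-2}}\,g$, and write $R(h)$ and $d\mathrm{vol}_h$ for the scalar curvature and the Riemannian volume measure of a metric $h$. Suppose that $\int_M R(g)\,d\mathrm{vol}_g$ exists in $[-\infty,\infty]$, i.e. that at least one of the integrals of the positive and of the negative part of $R(g)$ is finite. Then $\int_M R(g_i)\,d\mathrm{vol}_{g_i}$ exists in $[-\infty,\infty]$ for every $i$, and $$\int_M R(g_i)\,d\mathrm{vol}_{g_i}\longrightarrow\int_M R(g)\,d\mathrm{vol}_g\qquad(i\to\infty)$$ in $[-\infty,\infty]$. If moreover $R(g)$ is integrable with respect to $d\mathrm{vol}_g$,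 then every $R(g_i)$ is integrable with respect to $d\mathrm{vol}_{g_i}$, and the convergence is one of real numbers. -/

import Mathlib

open Bundle MeasureTheory Filter Topology
open scoped Manifold ContDiff

noncomputable section

/-! ### Scalar curvature of a matrix of metric coefficients on a coordinate domain -/

namespace Coord

variable {n : ℕ}

/-- The partial derivative `∂ᵢ f` at `y`. -/
def pd (i : Fin n) (f : EuclideanSpace ℝ (Fin n) → ℝ) (y : EuclideanSpace ℝ (Fin n)) : ℝ :=
  fderiv ℝ f y (EuclideanSpace.single i 1)

/-- The Christoffel symbol
`Γᵏᵢⱼ = ½ ∑ₗ Gᵏˡ (∂ᵢ Gⱼₗ + ∂ⱼ Gᵢₗ - ∂ₗ Gᵢⱼ)` of the metric coefficients `G`. -/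
def christoffel (G : EuclideanSpace ℝ (Fin n) → Matrix (Fin n) (Fin n) ℝ) (k i j : Fin n)
    (y : EuclideanSpace ℝ (Fin n)) : ℝ :=
  (1 / 2 : ℝ) * ∑ l, (G y)⁻¹ k l *
    (pd i (fun z => G z j l) y + pd j (fun z => G z i l) y - pd l (fun z => G z i j) y)

/-- The Ricci tensor
`Ricᵢⱼ = ∑ₖ (∂ₖ Γᵏᵢⱼ - ∂ⱼ Γᵏᵢₖ) + ∑ₖₗ (Γᵏₖₗ Γˡᵢⱼ - Γᵏⱼₗ Γˡᵢₖ)` of the metric coefficients `G`. -/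
def ricci (G : EuclideanSpace ℝ (Fin n) → Matrix (Fin n) (Fin n) ℝ) (i j : Fin n)
    (y : EuclideanSpace ℝ (Fin n)) : ℝ :=
  (∑ k, (pd k (christoffel G k i j) y - pd j (christoffel G k i k) y)) +
    ∑ k, ∑ l, (christoffel G k k l y * christoffel G l i j y -
      christoffel G k j l y * christoffel G l i k y)

/-- The scalar curvature `R = ∑ᵢⱼ Gⁱʲ Ricᵢⱼ` of the metric coefficients `G`. -/
def scalar (G : EuclideanSpace ℝ (Fin n) → Matrix (Fin n) (Fin n) ℝ)
    (y : EuclideanSpace ℝ (Fin n)) : ℝ :=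
  ∑ i, ∑ j, (G y)⁻¹ i j * ricci G i j y

end Coord

/-! ### Riemannian metrics of class `C²` on a smooth `n`-manifold -/

section Manifold

variable {n : ℕ} {M : Type*} [TopologicalSpace M] [ChartedSpace (EuclideanSpace ℝ (Fin n)) M]
  [IsManifold (𝓡 n) ∞ M]

variable (n M) in
/-- A Riemannian metric of class `C²` on the tangent bundle of `M`. -/
abbrev C2Metric : Type _ :=
  ContMDiffRiemannianMetric (𝓡 n) 2 (EuclideanSpace ℝ (Fin n))
    (fun x : M => TangentSpace (𝓡 n) x)

/-- The coordinate vector field `∂ᵢ` of the chart `e`, at the point with coordinates `y`. -/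
def coordVector (e : OpenPartialHomeomorph M (EuclideanSpace ℝ (Fin n))) (i : Fin n)
    (y : EuclideanSpace ℝ (Fin n)) : TangentSpace (𝓡 n) (e.symm y) :=
  mfderiv 𝓘(ℝ, EuclideanSpace ℝ (Fin n)) (𝓡 n) e.symm y
    (EuclideanSpace.single i (1 : ℝ) : EuclideanSpace ℝ (Fin n))

/-- The metric coefficients `gᵢⱼ = g(∂ᵢ, ∂ⱼ)` in the chart `e`, as a function of the
coordinates. -/
def metricCoeff (g : C2Metric n M) (e : OpenPartialHomeomorph M (EuclideanSpace ℝ (Fin n)))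
    (y : EuclideanSpace ℝ (Fin n)) : Matrix (Fin n) (Fin n) ℝ :=
  Matrix.of fun i j => g.inner (e.symm y) (coordVector e i y) (coordVector e j y)

/-- The scalar curvature `R(g)(x)`, computed in the preferred chart at `x` (its value does not
depend on the chart). -/
def scalarCurvature (g : C2Metric n M) (x : M) : ℝ :=
  Coord.scalar (metricCoeff g (chartAt (EuclideanSpace ℝ (Fin n)) x))
    (chartAt (EuclideanSpace ℝ (Fin n)) x x)

/-- The Riemannian volume in the chart `e`: the measure `√(det gᵢⱼ) dy` on the target of `e`,
transported to the source of `e`. -/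
def chartVolume [MeasurableSpace M] (g : C2Metric n M)
    (e : OpenPartialHomeomorph M (EuclideanSpace ℝ (Fin n))) : Measure M :=
  ((volume.restrict e.target).withDensity
    fun y => ENNReal.ofReal √((metricCoeff g e y).det)).map e.symm

/-- A sequence of points whose preferred charts cover `M`. -/
theorem exists_chart_cover (n : ℕ) (M : Type*) [TopologicalSpace M]
    [ChartedSpace (EuclideanSpace ℝ (Fin n)) M] [SecondCountableTopology M] [Nonempty M] :
    ∃ c : ℕ → M, ⋃ k, (chartAt (EuclideanSpace ℝ (Fin n)) (c k)).source = Set.univ := by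
  obtain ⟨s, hs, hU⟩ := TopologicalSpace.countable_cover_nhds
    (fun x : M => chart_source_mem_nhds (EuclideanSpace ℝ (Fin n)) x)
  have hne : s.Nonempty := by
    obtain ⟨x⟩ := ‹Nonempty M›
    have hx : x ∈ ⋃ y ∈ s, (chartAt (EuclideanSpace ℝ (Fin n)) y).source := hU ▸ Set.mem_univ x
    simp only [Set.mem_iUnion] at hx
    obtain ⟨y, hy, -⟩ := hx
    exact ⟨y, hy⟩
  obtain ⟨c, rfl⟩ := hs.exists_eq_range hne
  exact ⟨c, by simpa using hU⟩

variable (n M) in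
/-- A fixed countable family of charts covering `M`. -/
def chartSeq [SecondCountableTopology M] [Nonempty M] (k : ℕ) :
    OpenPartialHomeomorph M (EuclideanSpace ℝ (Fin n)) :=
  chartAt (EuclideanSpace ℝ (Fin n)) ((exists_chart_cover n M).choose k)

/-- The Riemannian volume measure of `g`. The manifold is cut into countably many disjoint Borel
pieces, each contained in a chart domain, and on each piece the measure is the volume in that
chart. By the change of variables formula the result does not depend on the pieces. -/
def riemannianVolume [SecondCountableTopology M] [Nonempty M] [MeasurableSpace M]
    (g : C2Metric n M) : Measure M :=
  Measure.sum fun k : ℕ =>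
    (chartVolume g (chartSeq n M k)).restrict (disjointed (fun j => (chartSeq n M j).source) k)

set_option synthInstance.maxHeartbeats 200000 in
/-- For `u > 0` of class `C²`, the conformal metric `u ^ p • g`. -/
def C2Metric.conformal (g : C2Metric n M) (u : M → ℝ)
    (hu : ContMDiff (𝓡 n) 𝓘(ℝ, ℝ) 2 u) (hpos : ∀ x, 0 < u x) (p : ℝ) : C2Metric n M where
  inner x := (u x ^ p) • g.inner x
  symm x v w := by
    change u x ^ p * g.inner x v w = u x ^ p * g.inner x w v
    rw [g.symm x v w]
  pos x v hv := by
    change 0 < u x ^ p * g.inner x v v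
    exact mul_pos (Real.rpow_pos_of_pos (hpos x) p) (g.pos x v hv)
  isVonNBounded x := by
    have hp : 0 < u x ^ p := Real.rpow_pos_of_pos (hpos x) p
    have hs : 0 < √(u x ^ p) := Real.sqrt_pos.2 hp
    refine ((g.isVonNBounded x).image
      ((√(u x ^ p))⁻¹ • ContinuousLinearMap.id ℝ (TangentSpace (𝓡 n) x))).subset ?_
    intro v hv
    refine ⟨√(u x ^ p) • v, ?_, ?_⟩
    · have hv' : u x ^ p * g.inner x v v < 1 := hv
      have : √(u x ^ p) * (√(u x ^ p) * g.inner x v v) < 1 := by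
        rwa [← mul_assoc, Real.mul_self_sqrt hp.le]
      simpa using this
    · simp [smul_smul, hs.ne']
  contMDiff := by
    have h : ContMDiff (𝓡 n) 𝓘(ℝ, ℝ) 2 (fun x => u x ^ p) := fun x =>
      (Real.contDiffAt_rpow_const_of_ne (p := p) (hpos x).ne').contMDiffAt.comp x (hu x)
    exact h.smul_section g.contMDiff

/-- Uniform convergence in the `C¹` sense on `(M, g)`: the functions converge uniformly, and the
pointwise norms `|d(uᵢ) - dv|_g` converge to `0` uniformly on `M`. -/
def TendstoUniformlyC1 (g : C2Metric n M) (u : ℕ → M → ℝ) (v : M → ℝ) : Prop :=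
  TendstoUniformly u v atTop ∧
    ∀ ε : ℝ, 0 < ε → ∀ᶠ i in atTop, ∀ (x : M) (w : TangentSpace (𝓡 n) x),
      |(show ℝ from mfderiv (𝓡 n) 𝓘(ℝ, ℝ) (u i) x w) -
        (show ℝ from mfderiv (𝓡 n) 𝓘(ℝ, ℝ) v x w)| ≤ ε * √(g.inner x w w)

end Manifold

/-! ### Integrals with values in the extended reals -/

section Integral

variable {α : Type*} [MeasurableSpace α]

/-- The integral of the real function `f` exists in `[-∞, ∞]`: `f` is measurable, and at least one
of `∫ f⁺` and `∫ f⁻` is finite. -/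
def HasExtIntegral (f : α → ℝ) (μ : Measure α) : Prop :=
  AEMeasurable f μ ∧
    (∫⁻ x, ENNReal.ofReal (f x) ∂μ ≠ ⊤ ∨ ∫⁻ x, ENNReal.ofReal (-f x) ∂μ ≠ ⊤)

/-- The integral `∫ f⁺ - ∫ f⁻` in `[-∞, ∞]`; it is meaningful when `HasExtIntegral f μ`. -/
def extIntegral (f : α → ℝ) (μ : Measure α) : EReal :=
  ((∫⁻ x, ENNReal.ofReal (f x) ∂μ : ENNReal) : EReal) -
    ((∫⁻ x, ENNReal.ofReal (-f x) ∂μ : ENNReal) : EReal)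

end Integral

end

/-! Write `u` for one of the conformal factors, `p = 4/(n-2)` and `c = 4(n-1)/(n-2)`, and let Δ be
the divergence of the gradient. The conformal law is R(u^p g) = u^(-p) (R(g) - c Δu/u), and the
volume of u^p g has density u^(pn/2) = u^2 · u^p. The powers of `u` combine to R(u^p g) dvol = (u^2
R(g) - c u Δu) dvol_g. Since `u` is constant off a compact set, Green's formula turns the total
scalar curvature into ∫ u^2 R(g) + c ∫ |du|^2.

The factor u^2 tends to 1 uniformly. It therefore lies between 1-ε and 1+ε, which squeezes the
integrals of the positive and negative parts of u^2 R(g) separately, also when one of them is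
infinite (`tendsto_lintegral_ofReal_mul`, `tendsto_extIntegral_mul`). The Dirichlet energy lives on
`K`, which has finite volume, and is at most sup |du|^2 · vol(K); it tends to 0
(`tendsto_integral_dirichlet`). Adding a finite integral to an extended one is justified by
`extIntegral_add`.

The geometric input is proved in coordinates. `Coord.MetricOn.scalar_exp_conformal` computes the
curvature of exp(2φ) G from the change of the Christoffel symbols, and
`Coord.MetricOn.scalar_rpow_conformal` specialises it to the exponent for which the gradient terms
cancel. `Coord.MetricOn.integral_mul_lap` is integration by parts in a chart. It yields both the
chart independence of the Laplacian (`chartLaplacian_eq`), by testing against smooth functions, and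
Green's formula on `M` (`integral_mul_laplacian`), by a partition of unity.
`riemannianVolume_restrict_source` lets integrals over a chart domain be computed in that chart. -/

set_option linter.unusedSectionVars false

noncomputable section

namespace Coord

variable {n : ℕ}

/-! ### Algebra of a conformal change at a point -/

section Algebra

/-- The difference of the Christoffel symbols of `exp (2φ) G` and `G`, where `p = dφ` and `X` is
the gradient of `φ`. -/
def conformalTensor (G : Fin n → Fin n → ℝ) (p X : Fin n → ℝ) (k i j : Fin n) : ℝ :=
  (if k = j then p i else 0) + (if k = i then p j else 0) - G i j * X k

variable {G H : Fin n → Fin n → ℝ} {p X : Fin n → ℝ}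

theorem conformalTensor_symm (hG : ∀ i j, G i j = G j i) (k i j : Fin n) :
    conformalTensor G p X k i j = conformalTensor G p X k j i := by
  unfold conformalTensor
  rw [hG i j]; ring

theorem sum_conformalTensor_upper_right (hX : ∀ i, ∑ k, G i k * X k = p i) (i : Fin n) :
    ∑ k, conformalTensor G p X k i k = n * p i := by
  simp only [conformalTensor, Finset.sum_sub_distrib, Finset.sum_add_distrib, hX]
  simp

theorem sum_conformalTensor_upper_left (hG : ∀ i j, G i j = G j i)
    (hX : ∀ i, ∑ k, G i k * X k = p i) (i : Fin n) :
    ∑ k, conformalTensor G p X k k i = n * p i := by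
  rw [← sum_conformalTensor_upper_right hX]
  exact Finset.sum_congr rfl fun k _ => conformalTensor_symm hG _ _ _

theorem trace_inverse (hHG : ∀ i j, ∑ k, H i k * G k j = if i = j then 1 else 0)
    (hG : ∀ i j, G i j = G j i) : ∑ i, ∑ j, H i j * G i j = n := by
  have : ∀ i, ∑ j, H i j * G i j = 1 := fun i => by
    simpa [hG i] using hHG i i
  simp [this]

/-- Each of the two delta terms contributes `X l`; the metric term contributes `-n * X l` because
the trace of `G` is `n`. -/
theorem contract_conformalTensor (hHG : ∀ i j, ∑ k, H i k * G k j = if i = j then 1 else 0)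
    (hG : ∀ i j, G i j = G j i) (hH : ∀ i j, H i j = H j i)
    (hXp : ∀ k, X k = ∑ l, H k l * p l) (l : Fin n) :
    ∑ i, ∑ j, H i j * conformalTensor G p X l i j = (2 - n) * X l := by
  have h1 : ∑ i, ∑ j, H i j * (if l = j then p i else 0) = X l := by
    simp [hXp, hH l]
  have h2 : ∑ i, ∑ j, H i j * (if l = i then p j else 0) = X l := by
    rw [Finset.sum_comm]; simp [hXp]
  have h3 : ∑ i, ∑ j, H i j * (G i j * X l) = n * X l := by
    rw [← trace_inverse hHG hG, Finset.sum_mul]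
    simp_rw [Finset.sum_mul, mul_assoc]
  calc _ = ∑ i, ∑ j, (H i j * (if l = j then p i else 0) + H i j * (if l = i then p j else 0)
        - H i j * (G i j * X l)) := by
        simp only [conformalTensor, mul_add, mul_sub]
    _ = X l + X l - n * X l := by
        simp only [Finset.sum_sub_distrib, Finset.sum_add_distrib, h1, h2, h3]
    _ = _ := by ring

/-- The first delta term and the metric term both contract to the trace of `A` paired with `X`, with
opposite signs, so only the second delta term survives. -/
theorem contract_mul_conformalTensor
    (hHG : ∀ i j, ∑ k, H i k * G k j = if i = j then 1 else 0)
    (hH : ∀ i j, H i j = H j i)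
    (hXp : ∀ k, X k = ∑ l, H k l * p l) {A : Fin n → Fin n → Fin n → ℝ}
    (hA : ∀ k i j, A k i j = A k j i) :
    ∑ i, ∑ j, H i j * ∑ k, ∑ l, A k j l * conformalTensor G p X l i k =
      ∑ i, ∑ j, H i j * ∑ k, A k i j * p k := by
  have hin : ∀ i j, ∑ k, ∑ l, A k j l * conformalTensor G p X l i k =
      (∑ k, A k j k) * p i + ∑ k, A k i j * p k - ∑ k, ∑ l, A k j l * G i k * X l := by
    intro i j
    calc _ = ∑ k, ∑ l, (A k j l * (if l = k then p i else 0)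
          + A k j l * (if l = i then p k else 0) - A k j l * G i k * X l) := by
          simp only [conformalTensor, mul_add, mul_sub, mul_assoc]
      _ = _ := by
          simp only [Finset.sum_sub_distrib, Finset.sum_add_distrib]
          simp [Finset.sum_mul, fun k => hA k i j]
  have h1 : ∑ i, ∑ j, H i j * ((∑ k, A k j k) * p i) = ∑ j, (∑ k, A k j k) * X j := by
    rw [Finset.sum_comm]
    refine Finset.sum_congr rfl fun j _ => ?_
    rw [hXp, Finset.mul_sum]
    refine Finset.sum_congr rfl fun i _ => ?_
    rw [hH j i]; ring
  have h3 : ∑ i, ∑ j, H i j * ∑ k, ∑ l, A k j l * G i k * X l = ∑ j, (∑ k, A k j k) * X j := by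
    calc _ = ∑ j, ∑ k, (∑ i, H j i * G i k) * ∑ l, A k j l * X l := by
          rw [Finset.sum_comm]
          refine Finset.sum_congr rfl fun j _ => ?_
          simp_rw [Finset.mul_sum, Finset.sum_mul]
          rw [Finset.sum_comm]
          refine Finset.sum_congr rfl fun k _ => ?_
          rw [Finset.sum_comm]
          refine Finset.sum_congr rfl fun l _ => ?_
          refine Finset.sum_congr rfl fun i _ => ?_
          rw [hH j i]; ring
      _ = ∑ j, ∑ l, A j j l * X l := by simp [hHG]
      _ = _ := by
          rw [Finset.sum_comm]
          refine Finset.sum_congr rfl fun j _ => ?_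
          rw [Finset.sum_mul]
          exact Finset.sum_congr rfl fun k _ => by rw [hA]
  simp only [hin, mul_add, mul_sub, Finset.sum_sub_distrib, Finset.sum_add_distrib, h1, h3]
  ring

/-- The quadratic part of the Ricci tensor as a function of the Christoffel symbols. -/
def ricciQuad (A B : Fin n → Fin n → Fin n → ℝ) (i j : Fin n) : ℝ :=
  ∑ k, ∑ l, (A k k l * B l i j - A k j l * B l i k)

theorem contract_ricciQuad_conformalTensor
    (hHG : ∀ i j, ∑ k, H i k * G k j = if i = j then 1 else 0)
    (hG : ∀ i j, G i j = G j i) (hH : ∀ i j, H i j = H j i)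
    (hXp : ∀ k, X k = ∑ l, H k l * p l) {A : Fin n → Fin n → Fin n → ℝ}
    (hA : ∀ k i j, A k i j = A k j i) :
    ∑ i, ∑ j, H i j * ricciQuad A (conformalTensor G p X) i j =
      (2 - n) * (∑ l, (∑ k, A k k l) * X l) - ∑ i, ∑ j, H i j * ∑ k, A k i j * p k := by
  have h : ∀ i j, ricciQuad A (conformalTensor G p X) i j =
      (∑ l, (∑ k, A k k l) * conformalTensor G p X l i j) -
        ∑ k, ∑ l, A k j l * conformalTensor G p X l i k := by
    intro i j
    simp only [ricciQuad, Finset.sum_sub_distrib]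
    rw [Finset.sum_comm]
    simp only [Finset.sum_mul]
  simp only [h, mul_sub, Finset.sum_sub_distrib,
    contract_mul_conformalTensor hHG hH hXp hA]
  congr 1
  calc _ = ∑ l, (∑ k, A k k l) * ∑ i, ∑ j, H i j * conformalTensor G p X l i j := by
        simp_rw [Finset.mul_sum]
        conv_rhs => rw [Finset.sum_comm]; enter [2, i]; rw [Finset.sum_comm]
        refine Finset.sum_congr rfl fun i _ => Finset.sum_congr rfl fun j _ =>
          Finset.sum_congr rfl fun l _ => by ring
    _ = _ := by
        simp only [contract_conformalTensor hHG hG hH hXp]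
        rw [Finset.mul_sum]
        exact Finset.sum_congr rfl fun l _ => by ring

/-- The trace of the tensor is `n * p`, which gives `n` copies of the contraction; the crossed term
removes one by `contract_mul_conformalTensor`. -/
theorem contract_conformalTensor_ricciQuad
    (hHG : ∀ i j, ∑ k, H i k * G k j = if i = j then 1 else 0)
    (hG : ∀ i j, G i j = G j i) (hH : ∀ i j, H i j = H j i)
    (hXp : ∀ k, X k = ∑ l, H k l * p l) (hX : ∀ i, ∑ k, G i k * X k = p i)
    {A : Fin n → Fin n → Fin n → ℝ} (hA : ∀ k i j, A k i j = A k j i) :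
    ∑ i, ∑ j, H i j * ricciQuad (conformalTensor G p X) A i j =
      (n - 1) * ∑ i, ∑ j, H i j * ∑ k, A k i j * p k := by
  have h : ∀ i j, ricciQuad (conformalTensor G p X) A i j =
      n * (∑ l, A l i j * p l) - ∑ k, ∑ l, A k i l * conformalTensor G p X l j k := by
    intro i j
    simp only [ricciQuad, Finset.sum_sub_distrib]
    rw [Finset.sum_comm]
    simp only [← Finset.sum_mul, sum_conformalTensor_upper_left hG hX, Finset.mul_sum]
    congr 1
    · exact Finset.sum_congr rfl fun l _ => by ring
    · rw [Finset.sum_comm]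
      exact Finset.sum_congr rfl fun l _ => Finset.sum_congr rfl fun k _ => by ring
  have h2 : ∑ i, ∑ j, H i j * ∑ k, ∑ l, A k i l * conformalTensor G p X l j k =
      ∑ i, ∑ j, H i j * ∑ k, A k i j * p k := by
    rw [← contract_mul_conformalTensor hHG hH hXp hA, Finset.sum_comm]
    exact Finset.sum_congr rfl fun i _ => Finset.sum_congr rfl fun j _ => by rw [hH]
  simp only [h, mul_sub, Finset.sum_sub_distrib, h2]
  rw [sub_mul, one_mul]
  congr 1
  simp only [Finset.mul_sum]
  exact Finset.sum_congr rfl fun i _ => Finset.sum_congr rfl fun j _ =>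
    Finset.sum_congr rfl fun k _ => by ring

/-- `ricciQuad` is bilinear, so it expands into four terms. The two mixed ones are the preceding
lemmas, and the purely conformal one is the second of them with `A` replaced by the conformal
tensor, which has the required symmetry. -/
theorem contract_ricciQuad_add
    (hHG : ∀ i j, ∑ k, H i k * G k j = if i = j then 1 else 0)
    (hG : ∀ i j, G i j = G j i) (hH : ∀ i j, H i j = H j i)
    (hXp : ∀ k, X k = ∑ l, H k l * p l) (hX : ∀ i, ∑ k, G i k * X k = p i)
    {A : Fin n → Fin n → Fin n → ℝ} (hA : ∀ k i j, A k i j = A k j i)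
    {A' : Fin n → Fin n → Fin n → ℝ}
    (hA' : ∀ k i j, A' k i j = A k i j + conformalTensor G p X k i j) :
    ∑ i, ∑ j, H i j * ricciQuad A' A' i j = ∑ i, ∑ j, H i j * ricciQuad A A i j +
      (2 - n) * (∑ l, (∑ k, A k k l) * X l) +
      (n - 2) * (∑ i, ∑ j, H i j * ∑ k, A k i j * p k) +
      (n - 1) * (2 - n) * ∑ l, X l * p l := by
  have h : ∀ i j, ricciQuad A' A' i j = ricciQuad A A i j +
      ricciQuad A (conformalTensor G p X) i j + ricciQuad (conformalTensor G p X) A i j +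
      ricciQuad (conformalTensor G p X) (conformalTensor G p X) i j := by
    intro i j
    simp only [ricciQuad, ← Finset.sum_add_distrib, hA']
    exact Finset.sum_congr rfl fun i _ => Finset.sum_congr rfl fun j _ => by ring
  have hq : ∑ i, ∑ j, H i j * ∑ k, conformalTensor G p X k i j * p k =
      (2 - n) * ∑ l, X l * p l := by
    calc _ = ∑ k, (∑ i, ∑ j, H i j * conformalTensor G p X k i j) * p k := by
          simp_rw [Finset.mul_sum, Finset.sum_mul]
          conv_rhs => rw [Finset.sum_comm]; enter [2, i]; rw [Finset.sum_comm]
          exact Finset.sum_congr rfl fun i _ => Finset.sum_congr rfl fun j _ =>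
            Finset.sum_congr rfl fun k _ => by ring
      _ = _ := by
          simp only [contract_conformalTensor hHG hG hH hXp, Finset.mul_sum, mul_assoc]
  simp only [h, mul_add, Finset.sum_add_distrib,
    contract_ricciQuad_conformalTensor hHG hG hH hXp hA,
    contract_conformalTensor_ricciQuad hHG hG hH hXp hX hA,
    contract_conformalTensor_ricciQuad hHG hG hH hXp hX (conformalTensor_symm hG), hq]
  ring

end Algebra

end Coord

/-- Jacobi's formula for the derivative of a determinant. -/
theorem Matrix.hasFDerivAt_det {E ι : Type*} [NormedAddCommGroup E] [NormedSpace ℝ E] [Fintype ι]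
    [DecidableEq ι] {A : E → Matrix ι ι ℝ} {A' : ι → ι → E →L[ℝ] ℝ} {y : E}
    (h : ∀ i j, HasFDerivAt (fun z => A z i j) (A' i j) y) :
    HasFDerivAt (fun z => (A z).det) (∑ i, ∑ j, (A y).adjugate i j • A' j i) y := by
  simp only [Matrix.det_apply]
  have h1 : HasFDerivAt (fun z => ∑ σ : Equiv.Perm ι, Equiv.Perm.sign σ • ∏ i, A z (σ i) i)
      (∑ σ : Equiv.Perm ι, Equiv.Perm.sign σ • ∑ i, (∏ j ∈ Finset.univ.erase i, A y (σ j) j) •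
        A' (σ i) i) y := by
    refine HasFDerivAt.fun_sum fun σ _ => ?_
    have := HasFDerivAt.finsetProd (u := Finset.univ) (fun i _ => h (σ i) i)
    rcases Int.units_eq_one_or (Equiv.Perm.sign σ) with hs | hs
    · simpa [hs] using this
    · simpa [hs] using this.fun_neg
  refine h1.congr_fderiv ?_
  ext v
  simp only [_root_.sum_apply, _root_.smul_apply, smul_eq_mul]
  -- By Cramer's rule, row `i` of the adjugate applied to a vector is the determinant with column
  -- `i` replaced by that vector.
  have h2 : ∀ i, ∑ j, (A y).adjugate i j * A' j i v =
      ((A y).updateCol i fun j => A' j i v).det := by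
    intro i
    rw [← Matrix.cramer_apply, Matrix.cramer_eq_adjugate_mulVec]
    rfl
  simp only [h2, Matrix.det_apply]
  rw [Finset.sum_comm]
  refine Finset.sum_congr rfl fun σ _ => ?_
  rw [Finset.smul_sum]
  refine Finset.sum_congr rfl fun i _ => ?_
  congr 1
  rw [← Finset.mul_prod_erase Finset.univ _ (Finset.mem_univ i)]
  simp only [Matrix.updateCol_self, mul_comm]
  congr 1
  refine Finset.prod_congr rfl fun j hj => ?_
  rw [Matrix.updateCol_ne (Finset.ne_of_mem_erase hj)]

namespace Coord

variable {n : ℕ}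

/-! ### Rules for partial derivatives -/

section pd

variable {f h : EuclideanSpace ℝ (Fin n) → ℝ} {y : EuclideanSpace ℝ (Fin n)}

theorem pd_congr (i : Fin n) (hfh : f =ᶠ[𝓝 y] h) : pd i f y = pd i h y := by
  rw [pd, pd, hfh.fderiv_eq]

theorem pd_const (i : Fin n) (c : ℝ) : pd i (fun _ => c) y = 0 := by
  simp [pd]

theorem pd_add (i : Fin n) (hf : DifferentiableAt ℝ f y) (hh : DifferentiableAt ℝ h y) :
    pd i (fun z => f z + h z) y = pd i f y + pd i h y := by
  simp [pd, fderiv_fun_add hf hh]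

theorem pd_sub (i : Fin n) (hf : DifferentiableAt ℝ f y) (hh : DifferentiableAt ℝ h y) :
    pd i (fun z => f z - h z) y = pd i f y - pd i h y := by
  simp [pd, fderiv_fun_sub hf hh]

theorem pd_mul (i : Fin n) (hf : DifferentiableAt ℝ f y) (hh : DifferentiableAt ℝ h y) :
    pd i (fun z => f z * h z) y = pd i f y * h y + f y * pd i h y := by
  simp [pd, fderiv_fun_mul hf hh]; ring

theorem pd_const_mul (i : Fin n) (c : ℝ) (hf : DifferentiableAt ℝ f y) :
    pd i (fun z => c * f z) y = c * pd i f y := by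
  rw [pd_mul i (differentiableAt_const c) hf, pd_const]; ring

theorem pd_sum (i : Fin n) {ι : Type*} (s : Finset ι) {F : ι → EuclideanSpace ℝ (Fin n) → ℝ}
    (hF : ∀ a ∈ s, DifferentiableAt ℝ (F a) y) :
    pd i (fun z => ∑ a ∈ s, F a z) y = ∑ a ∈ s, pd i (F a) y := by
  simp [pd, fderiv_fun_sum hF]

theorem pd_comp (i : Fin n) {F : ℝ → ℝ} {F' : ℝ} (hF : HasDerivAt F F' (f y))
    (hf : DifferentiableAt ℝ f y) : pd i (fun z => F (f z)) y = F' * pd i f y := by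
  have := (hF.comp_hasFDerivAt y hf.hasFDerivAt).fderiv
  simp only [Function.comp_def] at this
  simp [pd, this]

theorem contDiffOn_pd {U : Set (EuclideanSpace ℝ (Fin n))} (hU : IsOpen U) {k m : WithTop ℕ∞}
    (hkm : m + 1 ≤ k) (hf : ContDiffOn ℝ k f U) (i : Fin n) : ContDiffOn ℝ m (pd i f) U :=
  (hf.fderiv_of_isOpen hU hkm).clm_apply contDiffOn_const

end pd

/-! ### Metric coefficients on an open set -/

/-- `G` is a matrix of `C²` functions on the open set `U`, symmetric and with positive
determinant. -/
structure MetricOn (G : EuclideanSpace ℝ (Fin n) → Matrix (Fin n) (Fin n) ℝ)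
    (U : Set (EuclideanSpace ℝ (Fin n))) : Prop where
  isOpen : IsOpen U
  contDiffOn : ∀ i j, ContDiffOn ℝ 2 (fun z => G z i j) U
  symm : ∀ z ∈ U, ∀ i j, G z i j = G z j i
  det_pos : ∀ z ∈ U, 0 < (G z).det

/-- The components of the gradient of `f`. -/
def grad (G : EuclideanSpace ℝ (Fin n) → Matrix (Fin n) (Fin n) ℝ)
    (f : EuclideanSpace ℝ (Fin n) → ℝ) (k : Fin n) (y : EuclideanSpace ℝ (Fin n)) : ℝ :=
  ∑ l, (G y)⁻¹ k l * pd l f y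

/-- The Laplacian of `f`, as the divergence of the gradient. -/
def lap (G : EuclideanSpace ℝ (Fin n) → Matrix (Fin n) (Fin n) ℝ)
    (f : EuclideanSpace ℝ (Fin n) → ℝ) (y : EuclideanSpace ℝ (Fin n)) : ℝ :=
  ∑ k, pd k (grad G f k) y + ∑ l, (∑ k, christoffel G k k l y) * grad G f l y

variable {G : EuclideanSpace ℝ (Fin n) → Matrix (Fin n) (Fin n) ℝ}
  {U : Set (EuclideanSpace ℝ (Fin n))} {y : EuclideanSpace ℝ (Fin n)}
  {f φ : EuclideanSpace ℝ (Fin n) → ℝ}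

theorem _root_.ContDiffOn.matrix_det {ι : Type*} [Fintype ι] [DecidableEq ι] {k : WithTop ℕ∞}
    {A : EuclideanSpace ℝ (Fin n) → Matrix ι ι ℝ}
    (h : ∀ i j, ContDiffOn ℝ k (fun z => A z i j) U) :
    ContDiffOn ℝ k (fun z => (A z).det) U := by
  simp only [Matrix.det_apply']
  exact ContDiffOn.sum fun σ _ => contDiffOn_const.mul (contDiffOn_prod fun i _ => h _ _)

namespace MetricOn

variable (hG : MetricOn G U)
include hG

theorem mem_nhds (hy : y ∈ U) : U ∈ 𝓝 y := hG.isOpen.mem_nhds hy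

/-- The inverse is the adjugate divided by the determinant, both polynomial in the entries. -/
theorem contDiffOn_inv (i j : Fin n) : ContDiffOn ℝ 2 (fun z => (G z)⁻¹ i j) U := by
  have h1 : ContDiffOn ℝ 2 (fun z => (G z).adjugate i j) U := by
    simp only [Matrix.adjugate_apply]
    refine ContDiffOn.matrix_det fun a b => ?_
    by_cases ha : a = j
    · subst ha; simpa using contDiffOn_const
    · simpa [Matrix.updateRow_ne ha] using hG.contDiffOn a b
  have h2 : ∀ z, (G z)⁻¹ i j = ((G z).det)⁻¹ * (G z).adjugate i j := fun z => by
    simp [Matrix.inv_def]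
  simp only [h2]
  exact ((ContDiffOn.matrix_det hG.contDiffOn).inv fun z hz => (hG.det_pos z hz).ne').mul h1

theorem inv_mul (hy : y ∈ U) (i j : Fin n) :
    ∑ k, (G y)⁻¹ i k * G y k j = if i = j then 1 else 0 := by
  have := Matrix.nonsing_inv_mul (G y) (hG.det_pos y hy).ne'.isUnit
  rw [← Matrix.mul_apply, this, Matrix.one_apply]

theorem mul_inv (hy : y ∈ U) (i j : Fin n) :
    ∑ k, G y i k * (G y)⁻¹ k j = if i = j then 1 else 0 := by
  have := Matrix.mul_nonsing_inv (G y) (hG.det_pos y hy).ne'.isUnit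
  rw [← Matrix.mul_apply, this, Matrix.one_apply]

theorem inv_symm (hy : y ∈ U) (i j : Fin n) : (G y)⁻¹ i j = (G y)⁻¹ j i := by
  have h : (G y).transpose = G y := by
    ext a b; exact hG.symm y hy b a
  have := Matrix.transpose_nonsing_inv (G y)
  rw [h] at this
  exact congrFun (congrFun this j) i

theorem differentiableAt (hy : y ∈ U) (i j : Fin n) : DifferentiableAt ℝ (fun z => G z i j) y :=
  ((hG.contDiffOn i j).contDiffAt (hG.mem_nhds hy)).differentiableAt (by norm_num)

theorem differentiableAt_inv (hy : y ∈ U) (i j : Fin n) :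
    DifferentiableAt ℝ (fun z => (G z)⁻¹ i j) y :=
  ((hG.contDiffOn_inv i j).contDiffAt (hG.mem_nhds hy)).differentiableAt (by norm_num)

theorem pd_symm (hy : y ∈ U) (l i j : Fin n) :
    pd l (fun z => G z i j) y = pd l (fun z => G z j i) y :=
  pd_congr l (Filter.eventually_of_mem (hG.mem_nhds hy) fun z hz => hG.symm z hz i j)

/-- Differentiate `G⁻¹ G = 1`, which holds near `y`, and multiply by `G⁻¹` on the right. -/
theorem pd_inv (hy : y ∈ U) (l i j : Fin n) :
    pd l (fun z => (G z)⁻¹ i j) y =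
      -∑ a, ∑ b, (G y)⁻¹ i a * pd l (fun z => G z a b) y * (G y)⁻¹ b j := by
  have h0 : ∀ b, ∑ a, (pd l (fun z => (G z)⁻¹ i a) y * G y a b +
      (G y)⁻¹ i a * pd l (fun z => G z a b) y) = 0 := by
    intro b
    have h1 : pd l (fun z => ∑ a, (G z)⁻¹ i a * G z a b) y = 0 := by
      rw [pd_congr l (h := fun _ => if i = b then 1 else 0)
        (Filter.eventually_of_mem (hG.mem_nhds hy) fun z hz => hG.inv_mul hz i b), pd_const]
    rw [pd_sum l _ fun a _ => (hG.differentiableAt_inv hy i a).fun_mul (hG.differentiableAt hy a b)]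
      at h1
    rw [← h1]
    exact Finset.sum_congr rfl fun a _ =>
      (pd_mul l (hG.differentiableAt_inv hy i a) (hG.differentiableAt hy a b)).symm
  have h2 : ∑ b, (∑ a, (pd l (fun z => (G z)⁻¹ i a) y * G y a b +
      (G y)⁻¹ i a * pd l (fun z => G z a b) y)) * (G y)⁻¹ b j = 0 := by simp [h0]
  have h3 : ∑ b, (∑ a, pd l (fun z => (G z)⁻¹ i a) y * G y a b) * (G y)⁻¹ b j =
      pd l (fun z => (G z)⁻¹ i j) y := by
    simp_rw [Finset.sum_mul]
    rw [Finset.sum_comm]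
    simp_rw [mul_assoc, ← Finset.mul_sum, hG.mul_inv hy]
    simp
  simp only [Finset.sum_add_distrib, add_mul, h3] at h2
  rw [eq_neg_of_add_eq_zero_left h2, Finset.sum_comm]
  simp_rw [Finset.sum_mul]

theorem contDiffOn_grad {k : WithTop ℕ∞} (hk : k + 1 ≤ 2) (hf : ContDiffOn ℝ 2 f U) (i : Fin n) :
    ContDiffOn ℝ k (grad G f i) U := by
  have hk2 : k ≤ 2 := le_self_add.trans hk
  exact ContDiffOn.sum fun l _ => ((hG.contDiffOn_inv i l).of_le hk2).mul
    (contDiffOn_pd hG.isOpen hk hf l)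

theorem contDiffOn_christoffel (k i j : Fin n) : ContDiffOn ℝ 1 (christoffel G k i j) U := by
  have h12 : (1 : WithTop ℕ∞) + 1 ≤ 2 := by norm_num
  have h : ∀ a b c, ContDiffOn ℝ 1 (pd a (fun z => G z b c)) U := fun a b c =>
    contDiffOn_pd hG.isOpen h12 (hG.contDiffOn b c) a
  exact contDiffOn_const.mul (ContDiffOn.sum fun l _ =>
    ((hG.contDiffOn_inv k l).of_le (by norm_num)).mul (((h _ _ _).add (h _ _ _)).sub (h _ _ _)))

theorem continuousOn_lap (hf : ContDiffOn ℝ 2 f U) : ContinuousOn (lap G f) U := by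
  have h1 : (1 : WithTop ℕ∞) + 1 ≤ 2 := by norm_num
  refine (continuousOn_finsetSum _ fun k _ => ?_).add (continuousOn_finsetSum _ fun l _ =>
    (continuousOn_finsetSum _ fun k _ => ?_).mul ?_)
  · exact (contDiffOn_pd (m := 0) hG.isOpen (by norm_num)
      (hG.contDiffOn_grad h1 hf k) k).continuousOn
  · exact (hG.contDiffOn_christoffel k k l).continuousOn
  · exact (hG.contDiffOn_grad h1 hf l).continuousOn

theorem christoffel_symm (hy : y ∈ U) (k i j : Fin n) :
    christoffel G k i j y = christoffel G k j i y := by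
  unfold christoffel
  congr 1
  refine Finset.sum_congr rfl fun l _ => ?_
  rw [hG.pd_symm hy l i j]; ring

/-- In the trace, two of the three derivative terms cancel by the symmetry of `G` and of its
inverse. -/
theorem sum_christoffel (hy : y ∈ U) (l : Fin n) : ∑ k, christoffel G k k l y =
    (1 / 2) * ∑ i, ∑ j, (G y)⁻¹ i j * pd l (fun z => G z i j) y := by
  unfold christoffel
  rw [← Finset.mul_sum]
  congr 1
  have : ∑ k, ∑ j, (G y)⁻¹ k j * pd k (fun z => G z l j) y =
      ∑ k, ∑ j, (G y)⁻¹ k j * pd j (fun z => G z k l) y := by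
    rw [Finset.sum_comm]
    refine Finset.sum_congr rfl fun i _ => Finset.sum_congr rfl fun j _ => ?_
    rw [hG.inv_symm hy, hG.pd_symm hy]
  simp only [mul_add, mul_sub, Finset.sum_add_distrib, Finset.sum_sub_distrib, this]
  ring

theorem sum_mul_grad (hy : y ∈ U) (i : Fin n) : ∑ k, G y i k * grad G f k y = pd i f y := by
  unfold grad
  simp_rw [Finset.mul_sum]
  rw [Finset.sum_comm]
  simp_rw [← mul_assoc, ← Finset.sum_mul, hG.mul_inv hy]
  simp

/-- By this identity `√(det G)` times the Laplacian is the ordinary divergence of `√(det G)` times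
the gradient, the form that can be integrated by parts. -/
theorem pd_sqrt_det (hy : y ∈ U) (l : Fin n) : pd l (fun z => √(G z).det) y =
    √(G y).det * ∑ k, christoffel G k k l y := by
  have h := Matrix.hasFDerivAt_det fun i j => (hG.differentiableAt hy i j).hasFDerivAt
  have hd := hG.det_pos y hy
  rw [pd_comp l (Real.hasDerivAt_sqrt hd.ne') h.differentiableAt, hG.sum_christoffel hy]
  have : pd l (fun z => (G z).det) y =
      (G y).det * ∑ i, ∑ j, (G y)⁻¹ i j * pd l (fun z => G z i j) y := by
    rw [pd, h.fderiv]
    simp only [_root_.sum_apply, _root_.smul_apply, smul_eq_mul]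
    simp_rw [Finset.mul_sum]
    refine Finset.sum_congr rfl fun i _ => Finset.sum_congr rfl fun j _ => ?_
    rw [hG.pd_symm hy l i j, ← mul_assoc]
    congr 1
    simp [Matrix.inv_def, hd.ne']
  rw [this]
  have hs : √(G y).det ≠ 0 := (Real.sqrt_pos.2 hd).ne'
  field_simp
  rw [Real.sq_sqrt hd.le]

end MetricOn

end Coord

namespace Coord

variable {n : ℕ}

/-! ### The scalar curvature of a conformal metric -/

section Conformal

variable {G : EuclideanSpace ℝ (Fin n) → Matrix (Fin n) (Fin n) ℝ}
  {U : Set (EuclideanSpace ℝ (Fin n))} {y : EuclideanSpace ℝ (Fin n)}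
  {f φ : EuclideanSpace ℝ (Fin n) → ℝ}

theorem inv_smul_matrix {c : ℝ} (hc : c ≠ 0) {A : Matrix (Fin n) (Fin n) ℝ} (hA : A.det ≠ 0) :
    (c • A)⁻¹ = c⁻¹ • A⁻¹ := by
  refine Matrix.inv_eq_right_inv ?_
  rw [Matrix.smul_mul, Matrix.mul_smul, smul_smul, mul_inv_cancel₀ hc, one_smul,
    Matrix.mul_nonsing_inv A hA.isUnit]

namespace MetricOn

variable (hG : MetricOn G U)
include hG

/-- The factor exp(2φ) cancels against its reciprocal in the inverse matrix. What is new comes from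
differentiating the factor: 2 dφ times `G`, which contracts with the inverse to two deltas and one
gradient term. -/
theorem christoffel_conformal (hφ : DifferentiableAt ℝ φ y) (hy : y ∈ U) (k i j : Fin n) :
    christoffel (fun z => Real.exp (2 * φ z) • G z) k i j y = christoffel G k i j y +
      conformalTensor (G y) (fun a => pd a φ y) (fun a => grad G φ a y) k i j := by
  have hpd : ∀ a b c, pd a (fun z => (Real.exp (2 * φ z) • G z) b c) y =
      Real.exp (2 * φ y) * (2 * pd a φ y * G y b c + pd a (fun z => G z b c) y) := by
    intro a b c
    have he : DifferentiableAt ℝ (fun z => 2 * φ z) y := hφ.const_mul 2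
    simp only [Matrix.smul_apply, smul_eq_mul]
    rw [pd_mul a he.exp (hG.differentiableAt hy b c),
      pd_comp a (Real.hasDerivAt_exp _) he, pd_const_mul a 2 hφ]
    ring
  have hE : Real.exp (2 * φ y) ≠ 0 := (Real.exp_pos _).ne'
  have hδ : ∀ a b, ∑ l, (G y)⁻¹ a l * G y b l = if a = b then 1 else 0 := fun a b => by
    rw [← hG.inv_mul hy]
    exact Finset.sum_congr rfl fun l _ => by rw [hG.symm y hy b l]
  have h1 : ∑ l, (G y)⁻¹ k l * (2 * pd i φ y * G y j l) = 2 * if k = j then pd i φ y else 0 := by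
    calc _ = 2 * pd i φ y * ∑ l, (G y)⁻¹ k l * G y j l := by
          rw [Finset.mul_sum]; exact Finset.sum_congr rfl fun l _ => by ring
      _ = _ := by rw [hδ]; split_ifs <;> ring
  have h2 : ∑ l, (G y)⁻¹ k l * (2 * pd j φ y * G y i l) = 2 * if k = i then pd j φ y else 0 := by
    calc _ = 2 * pd j φ y * ∑ l, (G y)⁻¹ k l * G y i l := by
          rw [Finset.mul_sum]; exact Finset.sum_congr rfl fun l _ => by ring
      _ = _ := by rw [hδ]; split_ifs <;> ring
  have h3 : ∑ l, (G y)⁻¹ k l * (2 * pd l φ y * G y i j) = 2 * (G y i j * grad G φ k y) := by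
    unfold grad
    rw [Finset.mul_sum, Finset.mul_sum]
    exact Finset.sum_congr rfl fun l _ => by ring
  unfold christoffel
  simp only [hpd, inv_smul_matrix hE (hG.det_pos y hy).ne']
  have h4 : ∀ l, (Real.exp (2 * φ y))⁻¹ • (G y)⁻¹ k l *
      (Real.exp (2 * φ y) * (2 * pd i φ y * G y j l + pd i (fun z => G z j l) y) +
      Real.exp (2 * φ y) * (2 * pd j φ y * G y i l + pd j (fun z => G z i l) y) -
      Real.exp (2 * φ y) * (2 * pd l φ y * G y i j + pd l (fun z => G z i j) y)) =
      (G y)⁻¹ k l * (pd i (fun z => G z j l) y + pd j (fun z => G z i l) y -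
        pd l (fun z => G z i j) y) + (G y)⁻¹ k l * (2 * pd i φ y * G y j l) +
        (G y)⁻¹ k l * (2 * pd j φ y * G y i l) - (G y)⁻¹ k l * (2 * pd l φ y * G y i j) := by
    intro l
    rw [smul_eq_mul]
    field_simp
    ring
  have h5 : ∑ l, ((Real.exp (2 * φ y))⁻¹ • (G y)⁻¹) k l *
      (Real.exp (2 * φ y) * (2 * pd i φ y * G y j l + pd i (fun z => G z j l) y) +
      Real.exp (2 * φ y) * (2 * pd j φ y * G y i l + pd j (fun z => G z i l) y) -
      Real.exp (2 * φ y) * (2 * pd l φ y * G y i j + pd l (fun z => G z i j) y)) = _ :=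
    Finset.sum_congr rfl fun l _ => h4 l
  rw [h5]
  simp only [Finset.sum_sub_distrib, Finset.sum_add_distrib, h1, h2, h3, conformalTensor]
  ring

/-- This is the derivative part of the change of the scalar curvature. The metric term of the tensor
produces derivatives of `G` and `n` times the coordinate divergence of the gradient; these recombine
into Laplacians only in `scalar_exp_conformal`. -/
theorem contract_pd_conformalTensor (hφ : ContDiffOn ℝ 2 φ U) (hy : y ∈ U) :
    ∑ i, ∑ j, (G y)⁻¹ i j * ∑ k,
      (pd k (fun z => conformalTensor (G z) (fun a => pd a φ z) (fun a => grad G φ a z) k i j) y -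
      pd j (fun z => conformalTensor (G z) (fun a => pd a φ z) (fun a => grad G φ a z) k i k) y) =
    (2 - n) * ∑ i, ∑ j, (G y)⁻¹ i j * pd i (pd j φ) y -
      ∑ i, ∑ j, (G y)⁻¹ i j * ∑ k, pd k (fun z => G z i j) y * grad G φ k y -
      n * ∑ k, pd k (grad G φ k) y := by
  have h12 : (1 : WithTop ℕ∞) + 1 ≤ 2 := by norm_num
  have hU := hG.mem_nhds hy
  have hp : ∀ a, DifferentiableAt ℝ (pd a φ) y := fun a =>
    ((contDiffOn_pd hG.isOpen h12 hφ a).contDiffAt hU).differentiableAt (by norm_num)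
  have hX : ∀ a, DifferentiableAt ℝ (grad G φ a) y := fun a =>
    ((hG.contDiffOn_grad h12 hφ a).contDiffAt hU).differentiableAt (by norm_num)
  have hite : ∀ (P : Prop) [Decidable P] (a : Fin n),
      DifferentiableAt ℝ (fun z => if P then pd a φ z else 0) y := by
    intro P _ a
    by_cases h : P
    · simpa [h] using hp a
    · simp [h]
  have hpite : ∀ (P : Prop) [Decidable P] (l a : Fin n),
      pd l (fun z => if P then pd a φ z else 0) y = if P then pd l (pd a φ) y else 0 := by
    intro P _ l a
    by_cases h : P
    · simp [h]
    · simp [h, pd_const]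
  have hS : ∀ k i j, DifferentiableAt ℝ (fun z =>
      conformalTensor (G z) (fun a => pd a φ z) (fun a => grad G φ a z) k i j) y :=
    fun k i j => ((hite _ _).add (hite _ _)).sub ((hG.differentiableAt hy i j).mul (hX k))
  have hpS : ∀ k i j, pd k (fun z =>
      conformalTensor (G z) (fun a => pd a φ z) (fun a => grad G φ a z) k i j) y =
      (if k = j then pd k (pd i φ) y else 0) + (if k = i then pd k (pd j φ) y else 0) -
        (pd k (fun z => G z i j) y * grad G φ k y + G y i j * pd k (grad G φ k) y) := by
    intro k i j
    unfold conformalTensor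
    rw [pd_sub k ((hite _ _).fun_add (hite _ _)) ((hG.differentiableAt hy i j).fun_mul (hX k)),
      pd_add k (hite _ _) (hite _ _), pd_mul k (hG.differentiableAt hy i j) (hX k), hpite, hpite]
  -- The trace identity holds on all of `U`, so it may be differentiated.
  have htr : ∀ i j, ∑ k, pd j (fun z =>
      conformalTensor (G z) (fun a => pd a φ z) (fun a => grad G φ a z) k i k) y =
      n * pd j (pd i φ) y := by
    intro i j
    rw [← pd_sum j _ fun k _ => hS k i k, ← pd_const_mul j _ (hp i)]
    exact pd_congr j (Filter.eventually_of_mem hU fun z hz =>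
      sum_conformalTensor_upper_right (fun a => hG.sum_mul_grad hz a) i)
  have hsymm : ∑ i, ∑ j, (G y)⁻¹ i j * pd j (pd i φ) y =
      ∑ i, ∑ j, (G y)⁻¹ i j * pd i (pd j φ) y := by
    rw [Finset.sum_comm]
    exact Finset.sum_congr rfl fun i _ => Finset.sum_congr rfl fun j _ => by rw [hG.inv_symm hy]
  have htrace : ∀ c : ℝ, ∑ i, ∑ j, (G y)⁻¹ i j * (G y i j * c) = n * c := by
    intro c
    rw [← trace_inverse (hG.inv_mul hy) (hG.symm y hy), Finset.sum_mul]
    simp_rw [Finset.sum_mul, mul_assoc]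
  have hin : ∀ i j, ∑ k,
      (pd k (fun z => conformalTensor (G z) (fun a => pd a φ z) (fun a => grad G φ a z) k i j) y -
      pd j (fun z => conformalTensor (G z) (fun a => pd a φ z) (fun a => grad G φ a z) k i k) y) =
      pd j (pd i φ) y + pd i (pd j φ) y - ∑ k, pd k (fun z => G z i j) y * grad G φ k y -
        G y i j * ∑ k, pd k (grad G φ k) y - n * pd j (pd i φ) y := by
    intro i j
    rw [Finset.sum_sub_distrib, htr]
    simp only [hpS, Finset.sum_sub_distrib, Finset.sum_add_distrib, Finset.mul_sum]
    simp
    ring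
  simp only [hin, mul_add, mul_sub, Finset.sum_sub_distrib, Finset.sum_add_distrib, htrace, hsymm]
  have : ∑ i, ∑ j, (G y)⁻¹ i j * (n * pd j (pd i φ) y) =
      n * ∑ i, ∑ j, (G y)⁻¹ i j * pd i (pd j φ) y := by
    rw [← hsymm]
    simp_rw [Finset.mul_sum]
    exact Finset.sum_congr rfl fun i _ => Finset.sum_congr rfl fun j _ => by ring
  rw [this]
  ring

theorem contract_pd_metric (hy : y ∈ U) (X : Fin n → ℝ) :
    ∑ i, ∑ j, (G y)⁻¹ i j * ∑ k, pd k (fun z => G z i j) y * X k =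
      2 * ∑ l, (∑ k, christoffel G k k l y) * X l := by
  simp_rw [hG.sum_christoffel hy]
  calc _ = ∑ l, (∑ i, ∑ j, (G y)⁻¹ i j * pd l (fun z => G z i j) y) * X l := by
        simp_rw [Finset.mul_sum, Finset.sum_mul]
        conv_rhs => rw [Finset.sum_comm]; enter [2, i]; rw [Finset.sum_comm]
        exact Finset.sum_congr rfl fun i _ => Finset.sum_congr rfl fun j _ =>
          Finset.sum_congr rfl fun k _ => by ring
    _ = _ := by
        rw [Finset.mul_sum]
        exact Finset.sum_congr rfl fun l _ => by ring

/-- The trace of the covariant Hessian is the divergence of the gradient. The derivative of `G⁻¹` in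
the divergence matches the terms ∂ᵢ Gⱼᵦ in the contracted Christoffel symbols. -/
theorem trace_hessian_eq_lap (hφ : ContDiffOn ℝ 2 φ U) (hy : y ∈ U) :
    ∑ i, ∑ j, (G y)⁻¹ i j * pd i (pd j φ) y -
      ∑ i, ∑ j, (G y)⁻¹ i j * ∑ k, christoffel G k i j y * pd k φ y = lap G φ y := by
  have h12 : (1 : WithTop ℕ∞) + 1 ≤ 2 := by norm_num
  have hU := hG.mem_nhds hy
  have hp : ∀ a, DifferentiableAt ℝ (pd a φ) y := fun a =>
    ((contDiffOn_pd hG.isOpen h12 hφ a).contDiffAt hU).differentiableAt (by norm_num)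
  have hgrad : ∀ b, ∑ l, (G y)⁻¹ b l * pd l φ y = grad G φ b y := fun b => rfl
  have hD : ∑ k, pd k (grad G φ k) y = ∑ i, ∑ j, (G y)⁻¹ i j * pd i (pd j φ) y -
      ∑ i, ∑ j, (G y)⁻¹ i j * ∑ b, pd i (fun z => G z j b) y * grad G φ b y := by
    have h1 : ∀ k, pd k (grad G φ k) y = ∑ l, (G y)⁻¹ k l * pd k (pd l φ) y -
        ∑ j, (G y)⁻¹ k j * ∑ b, pd k (fun z => G z j b) y * grad G φ b y := by
      intro k
      have h2 : pd k (grad G φ k) y = ∑ l, (pd k (fun z => (G z)⁻¹ k l) y * pd l φ y +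
          (G y)⁻¹ k l * pd k (pd l φ) y) := by
        unfold grad
        rw [pd_sum k _ fun l _ => (hG.differentiableAt_inv hy k l).fun_mul (hp l)]
        exact Finset.sum_congr rfl fun l _ => pd_mul k (hG.differentiableAt_inv hy k l) (hp l)
      rw [h2, Finset.sum_add_distrib, add_comm, sub_eq_add_neg]
      congr 1
      simp only [hG.pd_inv hy, ← hgrad, neg_mul, Finset.sum_neg_distrib, Finset.sum_mul,
        Finset.mul_sum]
      congr 1
      rw [Finset.sum_comm]
      refine Finset.sum_congr rfl fun a _ => ?_
      rw [Finset.sum_comm]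
      exact Finset.sum_congr rfl fun b _ => Finset.sum_congr rfl fun l _ => by ring
    simp only [h1, Finset.sum_sub_distrib]
  have hP : ∑ i, ∑ j, (G y)⁻¹ i j * ∑ k, christoffel G k i j y * pd k φ y =
      ∑ i, ∑ j, (G y)⁻¹ i j * ∑ b, pd i (fun z => G z j b) y * grad G φ b y -
        ∑ l, (∑ k, christoffel G k k l y) * grad G φ l y := by
    have h1 : ∀ i j, ∑ k, christoffel G k i j y * pd k φ y = (1 / 2) * ∑ l,
        (pd i (fun z => G z j l) y + pd j (fun z => G z i l) y - pd l (fun z => G z i j) y) *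
          grad G φ l y := by
      intro i j
      unfold christoffel grad
      simp only [Finset.mul_sum, Finset.sum_mul]
      rw [Finset.sum_comm]
      refine Finset.sum_congr rfl fun a _ => Finset.sum_congr rfl fun b _ => ?_
      rw [hG.inv_symm hy b a]; ring
    have h2 : ∑ i, ∑ j, (G y)⁻¹ i j * ∑ b, pd j (fun z => G z i b) y * grad G φ b y =
        ∑ i, ∑ j, (G y)⁻¹ i j * ∑ b, pd i (fun z => G z j b) y * grad G φ b y := by
      rw [Finset.sum_comm]
      exact Finset.sum_congr rfl fun i _ => Finset.sum_congr rfl fun j _ => by rw [hG.inv_symm hy]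
    have h3 := hG.contract_pd_metric hy fun l => grad G φ l y
    have h4 : ∀ i j, (G y)⁻¹ i j * ∑ k, christoffel G k i j y * pd k φ y = (1 / 2) *
        ((G y)⁻¹ i j * ∑ b, pd i (fun z => G z j b) y * grad G φ b y +
        (G y)⁻¹ i j * ∑ b, pd j (fun z => G z i b) y * grad G φ b y -
        (G y)⁻¹ i j * ∑ b, pd b (fun z => G z i j) y * grad G φ b y) := by
      intro i j
      rw [h1]
      simp only [add_mul, sub_mul, Finset.sum_sub_distrib, Finset.sum_add_distrib]
      ring
    simp only [h4, ← Finset.mul_sum, Finset.sum_sub_distrib, Finset.sum_add_distrib, h2]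
    simp only [h3]
    ring
  rw [lap, hD, hP]
  ring

theorem scalar_exp_conformal (hφ : ContDiffOn ℝ 2 φ U) (hy : y ∈ U) :
    scalar (fun z => Real.exp (2 * φ z) • G z) y = Real.exp (-2 * φ y) *
      (scalar G y - 2 * (n - 1) * lap G φ y -
        (n - 1) * (n - 2) * ∑ l, grad G φ l y * pd l φ y) := by
  have h12 : (1 : WithTop ℕ∞) + 1 ≤ 2 := by norm_num
  have hU := hG.mem_nhds hy
  have hE : Real.exp (2 * φ y) ≠ 0 := (Real.exp_pos _).ne'
  have hφ' : ∀ z ∈ U, DifferentiableAt ℝ φ z := fun z hz =>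
    (hφ.contDiffAt (hG.mem_nhds hz)).differentiableAt (by norm_num)
  have hp : ∀ a, DifferentiableAt ℝ (pd a φ) y := fun a =>
    ((contDiffOn_pd hG.isOpen h12 hφ a).contDiffAt hU).differentiableAt (by norm_num)
  have hX : ∀ a, DifferentiableAt ℝ (grad G φ a) y := fun a =>
    ((hG.contDiffOn_grad h12 hφ a).contDiffAt hU).differentiableAt (by norm_num)
  have hite : ∀ (P : Prop) [Decidable P] (a : Fin n),
      DifferentiableAt ℝ (fun z => if P then pd a φ z else 0) y := by
    intro P _ a
    by_cases h : P
    · simpa [h] using hp a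
    · simp [h]
  have hS : ∀ k i j, DifferentiableAt ℝ (fun z =>
      conformalTensor (G z) (fun a => pd a φ z) (fun a => grad G φ a z) k i j) y :=
    fun k i j => ((hite _ _).add (hite _ _)).sub ((hG.differentiableAt hy i j).mul (hX k))
  have hΓ : ∀ k i j, DifferentiableAt ℝ (christoffel G k i j) y := fun k i j =>
    ((hG.contDiffOn_christoffel k i j).contDiffAt hU).differentiableAt (by norm_num)
  have hpd : ∀ m k i j, pd m (christoffel (fun z => Real.exp (2 * φ z) • G z) k i j) y =
      pd m (christoffel G k i j) y + pd m (fun z =>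
        conformalTensor (G z) (fun a => pd a φ z) (fun a => grad G φ a z) k i j) y := by
    intro m k i j
    rw [← pd_add m (hΓ k i j) (hS k i j)]
    exact pd_congr m (Filter.eventually_of_mem hU fun z hz =>
      hG.christoffel_conformal (hφ' z hz) hz k i j)
  have hric : ∀ i j, ricci (fun z => Real.exp (2 * φ z) • G z) i j y =
      ∑ k, (pd k (christoffel G k i j) y - pd j (christoffel G k i k) y) + ∑ k,
      (pd k (fun z => conformalTensor (G z) (fun a => pd a φ z) (fun a => grad G φ a z) k i j) y -
      pd j (fun z => conformalTensor (G z) (fun a => pd a φ z) (fun a => grad G φ a z) k i k) y) +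
      ricciQuad (fun k i j => christoffel (fun z => Real.exp (2 * φ z) • G z) k i j y)
        (fun k i j => christoffel (fun z => Real.exp (2 * φ z) • G z) k i j y) i j := by
    intro i j
    unfold ricci ricciQuad
    congr 1
    rw [← Finset.sum_add_distrib]
    exact Finset.sum_congr rfl fun k _ => by rw [hpd, hpd]; ring
  have hscal : scalar G y = ∑ i, ∑ j, (G y)⁻¹ i j *
      ∑ k, (pd k (christoffel G k i j) y - pd j (christoffel G k i k) y) +
      ∑ i, ∑ j, (G y)⁻¹ i j * ricciQuad (fun k i j => christoffel G k i j y)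
        (fun k i j => christoffel G k i j y) i j := by
    simp only [scalar, ricci, ricciQuad, mul_add, Finset.sum_add_distrib]
  have hexp : Real.exp (-2 * φ y) = (Real.exp (2 * φ y))⁻¹ := by
    rw [← Real.exp_neg]; ring_nf
  have hq := contract_ricciQuad_add (G := fun i j => G y i j) (H := fun i j => (G y)⁻¹ i j)
    (hG.inv_mul hy) (hG.symm y hy) (hG.inv_symm hy)
    (p := fun a => pd a φ y) (X := fun a => grad G φ a y) (fun k => rfl)
    (fun i => hG.sum_mul_grad hy i) (A := fun k i j => christoffel G k i j y)
    (fun k i j => hG.christoffel_symm hy k i j)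
    (fun k i j => hG.christoffel_conformal (hφ' y hy) hy k i j)
  have hmain : scalar (fun z => Real.exp (2 * φ z) • G z) y = (Real.exp (2 * φ y))⁻¹ *
      ∑ i, ∑ j, (G y)⁻¹ i j * ricci (fun z => Real.exp (2 * φ z) • G z) i j y := by
    unfold scalar
    simp only [inv_smul_matrix hE (hG.det_pos y hy).ne', Finset.mul_sum, Matrix.smul_apply,
      smul_eq_mul, mul_assoc]
  rw [hmain, hexp]
  congr 1
  simp only [hric, mul_add, Finset.sum_add_distrib]
  rw [hq, hG.contract_pd_conformalTensor hφ hy, hG.contract_pd_metric hy, hscal,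
    ← hG.trace_hessian_eq_lap hφ hy]
  have hD := hG.trace_hessian_eq_lap hφ hy
  rw [lap] at hD
  -- The Laplacian is now a traced Hessian throughout; `n` times `hD` accounts for the coordinate
  -- divergence of the gradient, which carries the coefficient `n`.
  linear_combination (n : ℝ) * hD

end MetricOn

end Conformal

end Coord

/-! ### Locality of the coordinate formulas, conformal factors that are powers, and integration by
parts in a chart. -/

namespace Coord

variable {n : ℕ} {G G' : EuclideanSpace ℝ (Fin n) → Matrix (Fin n) (Fin n) ℝ}
  {U : Set (EuclideanSpace ℝ (Fin n))} {y : EuclideanSpace ℝ (Fin n)}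
  {f v : EuclideanSpace ℝ (Fin n) → ℝ}

theorem christoffel_congr (h : G =ᶠ[𝓝 y] G') (k i j : Fin n) :
    christoffel G k i j y = christoffel G' k i j y := by
  have hpd : ∀ a b c, pd a (fun z => G z b c) y = pd a (fun z => G' z b c) y := fun a b c =>
    pd_congr a (h.mono fun z hz => by simp [hz])
  simp only [christoffel, hpd, h.eq_of_nhds]

/-- Agreement near `y` passes to agreement near all points close to `y`, so the Christoffel symbols
agree as germs and may be differentiated again. -/
theorem scalar_congr (h : G =ᶠ[𝓝 y] G') : scalar G y = scalar G' y := by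
  have hc : ∀ k i j, christoffel G k i j =ᶠ[𝓝 y] christoffel G' k i j := fun k i j =>
    h.eventuallyEq_nhds.mono fun z hz => christoffel_congr hz k i j
  have hpd : ∀ a k i j, pd a (christoffel G k i j) y = pd a (christoffel G' k i j) y :=
    fun a k i j => pd_congr a (hc k i j)
  have hc' : ∀ k i j, christoffel G k i j y = christoffel G' k i j y := christoffel_congr h
  simp only [scalar, ricci, hpd, hc', h.eq_of_nhds]

theorem lap_congr {f' : EuclideanSpace ℝ (Fin n) → ℝ} (h : f =ᶠ[𝓝 y] f') :
    lap G f y = lap G f' y := by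
  have hg : ∀ k, grad G f k =ᶠ[𝓝 y] grad G f' k := fun k =>
    h.eventuallyEq_nhds.mono fun z hz => by
      simp only [grad, fun l => pd_congr l hz]
  simp only [lap, fun k => pd_congr k (hg k), fun k => (hg k).eq_of_nhds]

theorem lap_const (c : ℝ) : lap G (fun _ => c) y = 0 := by
  have : ∀ k, grad G (fun _ => c) k = fun _ => 0 := fun k => by
    ext z; simp [grad, pd_const]
  simp [lap, this, pd_const]

namespace MetricOn

variable (hG : MetricOn G U)
include hG

theorem lap_const_mul_log (hv : ContDiffOn ℝ 2 v U) (hpos : ∀ z ∈ U, 0 < v z) (hy : y ∈ U)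
    (a : ℝ) : lap G (fun z => a * Real.log (v z)) y =
      a * (lap G v y / v y - (∑ l, grad G v l y * pd l v y) / v y ^ 2) := by
  have hU := hG.mem_nhds hy
  have hdv : ∀ z ∈ U, DifferentiableAt ℝ v z := fun z hz =>
    (hv.contDiffAt (hG.mem_nhds hz)).differentiableAt (by norm_num)
  have hX : ∀ k, DifferentiableAt ℝ (grad G v k) y := fun k =>
    ((hG.contDiffOn_grad (k := 1) (by norm_num) hv k).contDiffAt hU).differentiableAt (by norm_num)
  have hgrad : ∀ z ∈ U, ∀ k, grad G (fun z => a * Real.log (v z)) k z =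
      a * ((v z)⁻¹ * grad G v k z) := by
    intro z hz k
    have hl := (hdv z hz).log (hpos z hz).ne'
    simp only [grad, pd_const_mul _ a hl,
      pd_comp _ (Real.hasDerivAt_log (hpos z hz).ne') (hdv z hz), Finset.mul_sum]
    exact Finset.sum_congr rfl fun l _ => by ring
  have hvy := (hpos y hy).ne'
  have hpd : ∀ k, pd k (grad G (fun z => a * Real.log (v z)) k) y =
      a * (pd k (grad G v k) y / v y - grad G v k y * pd k v y / v y ^ 2) := by
    intro k
    have hi : DifferentiableAt ℝ (fun z => (v z)⁻¹) y := (hdv y hy).inv hvy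
    rw [pd_congr k (Filter.eventually_of_mem hU fun z hz => hgrad z hz k),
      pd_const_mul k a (hi.fun_mul (hX k)), pd_mul k hi (hX k),
      pd_comp k (hasDerivAt_inv hvy) (hdv y hy)]
    field_simp
    ring
  simp only [lap, hpd, hgrad y hy, ← Finset.mul_sum, Finset.sum_sub_distrib, ← Finset.sum_div]
  have : ∑ l, (∑ k, christoffel G k k l y) * (a * ((v y)⁻¹ * grad G v l y)) =
      a * ((∑ l, (∑ k, christoffel G k k l y) * grad G v l y) / v y) := by
    rw [Finset.sum_div, Finset.mul_sum]
    exact Finset.sum_congr rfl fun l _ => by field_simp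
  rw [this]
  ring

/-- Put φ = a log v with a = 2/(n-2). The Laplacian of the logarithm contributes 2(n-1)a |dv|²/v²
and the quadratic term -(n-1)(n-2)a² |dv|²/v². Both coefficients have absolute value 4(n-1)/(n-2),
so they cancel and only Δv/v remains. -/
theorem scalar_rpow_conformal (hn : 3 ≤ n) (hv : ContDiffOn ℝ 2 v U) (hpos : ∀ z ∈ U, 0 < v z)
    (hy : y ∈ U) :
    scalar (fun z => v z ^ (4 / ((n : ℝ) - 2)) • G z) y = (v y ^ (4 / ((n : ℝ) - 2)))⁻¹ *
      (scalar G y - 4 * (n - 1) / (n - 2) * (lap G v y / v y)) := by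
  have hn2 : (n : ℝ) - 2 ≠ 0 := by
    have : (3 : ℝ) ≤ n := by exact_mod_cast hn
    linarith
  have hvy := (hpos y hy).ne'
  set a : ℝ := 2 / ((n : ℝ) - 2) with ha
  have hexp : ∀ z ∈ U, v z ^ (4 / ((n : ℝ) - 2)) = Real.exp (2 * (a * Real.log (v z))) := by
    intro z hz
    rw [Real.rpow_def_of_pos (hpos z hz), ha]
    congr 1
    ring
  have hdv : DifferentiableAt ℝ v y :=
    (hv.contDiffAt (hG.mem_nhds hy)).differentiableAt (by norm_num)
  have hφ : ContDiffOn ℝ 2 (fun z => a * Real.log (v z)) U :=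
    contDiffOn_const.mul (hv.log fun z hz => (hpos z hz).ne')
  rw [scalar_congr (G' := fun z => Real.exp (2 * (a * Real.log (v z))) • G z)
    (Filter.eventually_of_mem (hG.mem_nhds hy) fun z hz => by simp only [hexp z hz]),
    hG.scalar_exp_conformal hφ hy, hG.lap_const_mul_log hv hpos hy, hexp y hy, ← Real.exp_neg]
  have hpd : ∀ l, pd l (fun z => a * Real.log (v z)) y = a * ((v y)⁻¹ * pd l v y) := fun l => by
    rw [pd_const_mul l a (hdv.log hvy), pd_comp l (Real.hasDerivAt_log hvy) hdv]
  have hq : ∑ l, grad G (fun z => a * Real.log (v z)) l y * pd l (fun z => a * Real.log (v z)) y =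
      a ^ 2 * ((∑ l, grad G v l y * pd l v y) / v y ^ 2) := by
    simp only [grad, hpd, Finset.sum_div, Finset.mul_sum, Finset.sum_mul]
    exact Finset.sum_congr rfl fun l _ => Finset.sum_congr rfl fun k _ => by field_simp
  rw [hq]
  congr 1
  · congr 1; ring
  · rw [ha]; field_simp; ring

/-- Integration by parts for the Laplacian in coordinates. -/
theorem integral_mul_lap {h : EuclideanSpace ℝ (Fin n) → ℝ} {K : Set (EuclideanSpace ℝ (Fin n))}
    (hf : ContDiffOn ℝ 2 f U) (hh : ContDiffOn ℝ 1 h U) (hK : IsCompact K) (hKU : K ⊆ U)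
    (hzero : ∀ z ∈ U, z ∉ K → h z = 0) :
    ∫ z in U, √(G z).det * (h z * lap G f z) =
      -∫ z in U, √(G z).det * ∑ k, pd k h z * grad G f k z := by
  -- Extending `h` by zero gives a `C¹` function on the whole space with support in `K`, so
  -- integration by parts has no boundary term.
  set h' := U.indicator h with hh'
  have hz' : ∀ z, z ∉ K → h' z = 0 := by
    intro z hz
    by_cases hzU : z ∈ U
    · rw [hh', Set.indicator_of_mem hzU, hzero z hzU hz]
    · exact Set.indicator_of_notMem hzU h
  have heq : ∀ z ∈ U, h' =ᶠ[𝓝 z] h := fun z hz =>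
    Filter.eventually_of_mem (hG.mem_nhds hz) fun w hw => Set.indicator_of_mem hw h
  have hc : ContDiff ℝ 1 h' := by
    rw [contDiff_iff_contDiffAt]
    intro z
    by_cases hzU : z ∈ U
    · exact (hh.contDiffAt (hG.mem_nhds hzU)).congr_of_eventuallyEq (heq z hzU)
    · have : h' =ᶠ[𝓝 z] fun _ => 0 := Filter.eventually_of_mem
        (hK.isClosed.isOpen_compl.mem_nhds fun hzK => hzU (hKU hzK)) fun w hw => hz' w hw
      exact contDiffAt_const.congr_of_eventuallyEq this
  have hts : tsupport h' ⊆ K := closure_minimal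
    (fun z hz => by_contra fun hzK => hz (hz' z hzK)) hK.isClosed
  have hpd0 : ∀ k z, z ∉ K → pd k h' z = 0 := by
    intro k z hz
    rw [pd_congr k (h := fun _ => 0) (Filter.eventually_of_mem
      (hK.isClosed.isOpen_compl.mem_nhds hz) fun w hw => hz' w hw), pd_const]
  have hpdc : ∀ k, Continuous (pd k h') := fun k =>
    (hc.continuous_fderiv (by norm_num)).clm_apply continuous_const
  have hint : ∀ {p q : EuclideanSpace ℝ (Fin n) → ℝ}, Continuous p → (∀ z, z ∉ K → p z = 0) →
      ContinuousOn q U → Integrable (fun z => p z * q z) := by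
    intro p q hp hp0 hq
    have h1 : IntegrableOn (fun z => p z * q z) K :=
      (hp.continuousOn.mul (hq.mono hKU)).integrableOn_compact hK
    refine (integrableOn_iff_integrable_of_support_subset fun z hz => ?_).1 h1
    by_contra hzK
    exact hz (by simp [hp0 z hzK])
  have hs : ContDiffOn ℝ 1 (fun z => √(G z).det) U :=
    ((ContDiffOn.matrix_det hG.contDiffOn).sqrt fun z hz => (hG.det_pos z hz).ne').of_le
      (by norm_num)
  have hX : ∀ k, ContDiffOn ℝ 1 (grad G f k) U := hG.contDiffOn_grad (by norm_num) hf
  have hY : ∀ k, ContDiffOn ℝ 1 (fun z => √(G z).det * grad G f k z) U := fun k => hs.mul (hX k)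
  have hYd : ∀ k, ∀ z ∈ U, DifferentiableAt ℝ (fun z => √(G z).det * grad G f k z) z :=
    fun k z hz => ((hY k).contDiffAt (hG.mem_nhds hz)).differentiableAt (by norm_num)
  have hYpd : ∀ k, ContinuousOn (pd k fun z => √(G z).det * grad G f k z) U := fun k =>
    (contDiffOn_pd (m := 0) hG.isOpen (by norm_num) (hY k) k).continuousOn
  have hibp : ∀ k, ∫ z, h' z * pd k (fun z => √(G z).det * grad G f k z) z =
      -∫ z, pd k h' z * (√(G z).det * grad G f k z) := fun k =>
    integral_mul_fderiv_eq_neg_fderiv_mul_of_integrable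
      (hint (hpdc k) (hpd0 k) (hY k).continuousOn) (hint hc.continuous hz' (hYpd k))
      (hint hc.continuous hz' (hY k).continuousOn)
      (fun z _ => hc.differentiable (by norm_num) z) (fun z hz => hYd k z (hKU (hts hz)))
  -- The weighted Laplacian is a coordinate divergence, by `pd_sqrt_det`.
  have hlap : ∀ z ∈ U, √(G z).det * (h z * lap G f z) =
      ∑ k, h' z * pd k (fun z => √(G z).det * grad G f k z) z := by
    intro z hz
    have hds : DifferentiableAt ℝ (fun z => √(G z).det) z :=
      (hs.contDiffAt (hG.mem_nhds hz)).differentiableAt (by norm_num)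
    have hdX : ∀ k, DifferentiableAt ℝ (grad G f k) z := fun k =>
      ((hX k).contDiffAt (hG.mem_nhds hz)).differentiableAt (by norm_num)
    have hpd : ∀ k, pd k (fun z => √(G z).det * grad G f k z) z =
        √(G z).det * (pd k (grad G f k) z + (∑ l, christoffel G l l k z) * grad G f k z) := by
      intro k
      rw [pd_mul k hds (hdX k), hG.pd_sqrt_det hz]
      ring
    rw [(heq z hz).eq_of_nhds, ← Finset.mul_sum]
    simp only [hpd, ← Finset.mul_sum, Finset.sum_add_distrib]
    rw [lap]
    ring
  have hU := hG.isOpen.measurableSet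
  rw [setIntegral_congr_fun hU hlap,
    setIntegral_eq_integral_of_forall_compl_eq_zero (fun z hz => by
      simp [hz' z fun hzK => hz (hKU hzK)]),
    integral_finsetSum _ fun k _ => hint hc.continuous hz' (hYpd k)]
  simp only [hibp, Finset.sum_neg_distrib]
  rw [← integral_finsetSum _ fun k _ => hint (hpdc k) (hpd0 k) (hY k).continuousOn]
  congr 1
  rw [← setIntegral_eq_integral_of_forall_compl_eq_zero (s := U) (fun z hz => by
    simp [fun k => hpd0 k z fun hzK => hz (hKU hzK)])]
  refine setIntegral_congr_fun hU fun z hz => ?_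
  simp only [Finset.mul_sum, fun k => pd_congr k (heq z hz)]
  exact Finset.sum_congr rfl fun k _ => by ring

end MetricOn

end Coord

section Manifold

variable {n : ℕ} {M : Type*} [TopologicalSpace M] [ChartedSpace (EuclideanSpace ℝ (Fin n)) M]
  [IsManifold (𝓡 n) ∞ M]

/-! ### Coordinate vectors and metric coefficients -/

variable {e : OpenPartialHomeomorph M (EuclideanSpace ℝ (Fin n))}
  {y : EuclideanSpace ℝ (Fin n)} {g : C2Metric n M}

theorem EuclideanSpace.sum_smul_single (v : EuclideanSpace ℝ (Fin n)) :
    ∑ i, v i • (EuclideanSpace.single i (1 : ℝ) : EuclideanSpace ℝ (Fin n)) = v := by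
  simpa using (EuclideanSpace.basisFun (Fin n) ℝ).sum_repr v

theorem sum_smul_coordVector (v : EuclideanSpace ℝ (Fin n)) :
    ∑ i, v i • coordVector e i y =
      mfderiv 𝓘(ℝ, EuclideanSpace ℝ (Fin n)) (𝓡 n) e.symm y v := by
  conv_rhs => rw [← EuclideanSpace.sum_smul_single v]
  erw [map_sum]
  refine Finset.sum_congr rfl fun i _ => ?_
  erw [map_smul]
  rfl

theorem exists_eq_sum_coordVector (he : e ∈ atlas (EuclideanSpace ℝ (Fin n)) M)
    (hy : y ∈ e.target) (w : TangentSpace (𝓡 n) (e.symm y)) :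
    ∃ v : EuclideanSpace ℝ (Fin n), w = ∑ i, v i • coordVector e i y := by
  obtain ⟨v, hv⟩ := (mdifferentiable_of_mem_atlas (I := 𝓡 n) he).symm.mfderiv_surjective hy w
  exact ⟨v, hv.symm.trans (sum_smul_coordVector (e := e) (y := y) v).symm⟩

theorem contMDiffOn_coordVector (he : e ∈ atlas (EuclideanSpace ℝ (Fin n)) M) (i : Fin n) :
    ContMDiffOn 𝓘(ℝ, EuclideanSpace ℝ (Fin n)) (𝓡 n).tangent 2
      (fun y => (⟨e.symm y, coordVector e i y⟩ : TangentBundle (𝓡 n) M)) e.target := by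
  have h1 : ContMDiffOn (𝓡 n) (𝓡 n) ∞ e.symm e.target :=
    contMDiffOn_symm_of_mem_maximalAtlas (IsManifold.subset_maximalAtlas he)
  have h2 := h1.contMDiffOn_tangentMapWithin (m := 2) (by decide) e.open_target.uniqueMDiffOn
  have h3 : ContMDiff 𝓘(ℝ, EuclideanSpace ℝ (Fin n)) (𝓡 n).tangent 2
      (fun y => (⟨y, (EuclideanSpace.single i (1 : ℝ) : EuclideanSpace ℝ (Fin n))⟩ :
        TangentBundle (𝓡 n) (EuclideanSpace ℝ (Fin n)))) := by
    intro y
    refine (contMDiffAt_section y).2 ?_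
    simpa using contMDiffAt_const
  refine (h2.comp h3.contMDiffOn fun y hy => hy).congr fun y hy => ?_
  simp only [Function.comp, tangentMapWithin, coordVector]
  rw [mfderivWithin_of_isOpen e.open_target hy]

theorem contDiffOn_metricCoeff (he : e ∈ atlas (EuclideanSpace ℝ (Fin n)) M) (i j : Fin n) :
    ContDiffOn ℝ 2 (fun y => metricCoeff g e y i j) e.target := by
  rw [← contMDiffOn_iff_contDiffOn]
  intro y hy
  have h1 : ContMDiffOn (𝓡 n) (𝓡 n) ∞ e.symm e.target :=
    contMDiffOn_symm_of_mem_maximalAtlas (IsManifold.subset_maximalAtlas he)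
  have : ContMDiffWithinAt 𝓘(ℝ, EuclideanSpace ℝ (Fin n)) ((𝓡 n).prod 𝓘(ℝ)) 2
      (fun m ↦ TotalSpace.mk' ℝ (E := Bundle.Trivial M ℝ) (e.symm m)
        (g.inner (e.symm m) (coordVector e i m) (coordVector e j m))) e.target y := by
    apply ContMDiffWithinAt.clm_bundle_apply₂ (F₁ := EuclideanSpace ℝ (Fin n))
      (F₂ := EuclideanSpace ℝ (Fin n))
    · exact ContMDiffAt.comp_contMDiffWithinAt y g.contMDiff.contMDiffAt
        ((h1 y hy).of_le (by decide))
    · exact contMDiffOn_coordVector he i y hy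
    · exact contMDiffOn_coordVector he j y hy
  simp only [contMDiffWithinAt_totalSpace] at this
  exact this.2

theorem metricCoeff_quadratic (v w : EuclideanSpace ℝ (Fin n)) :
    ∑ i, ∑ j, v i * metricCoeff g e y i j * w j =
      g.inner (e.symm y) (∑ i, v i • coordVector e i y) (∑ i, w i • coordVector e i y) := by
  simp only [map_sum, map_smul, _root_.sum_apply, _root_.smul_apply, smul_eq_mul,
    Finset.mul_sum, metricCoeff, Matrix.of_apply]
  rw [Finset.sum_comm]
  exact Finset.sum_congr rfl fun i _ => Finset.sum_congr rfl fun j _ => by ring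

theorem metricCoeff_posDef (he : e ∈ atlas (EuclideanSpace ℝ (Fin n)) M) (hy : y ∈ e.target) :
    (metricCoeff g e y).PosDef := by
  refine Matrix.PosDef.of_dotProduct_mulVec_pos ?_ fun x hx => ?_
  · ext i j
    exact g.symm _ _ _
  · have h := metricCoeff_quadratic (g := g) (e := e) (y := y) (WithLp.toLp 2 x) (WithLp.toLp 2 x)
    have h2 : star x ⬝ᵥ (metricCoeff g e y).mulVec x =
        ∑ i, ∑ j, x i * metricCoeff g e y i j * x j := by
      simp [dotProduct, Matrix.mulVec, Finset.mul_sum, mul_assoc]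
    rw [h2]
    refine lt_of_lt_of_eq (g.pos _ _ ?_) h.symm
    rw [sum_smul_coordVector]
    -- The derivative of the inverse chart is injective, so a nonzero coefficient vector gives a
    -- nonzero tangent vector.
    intro h0
    have hinj := (mdifferentiable_of_mem_atlas (I := 𝓡 n) he).symm.mfderiv_injective hy
    have := hinj (h0.trans (map_zero _).symm)
    exact hx (congrArg WithLp.ofLp this)

theorem metricOn_metricCoeff (g : C2Metric n M) (he : e ∈ atlas (EuclideanSpace ℝ (Fin n)) M) :
    Coord.MetricOn (metricCoeff g e) e.target where
  isOpen := e.open_target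
  contDiffOn := contDiffOn_metricCoeff he
  symm _ _ _ _ := g.symm _ _ _
  det_pos _ hz := (metricCoeff_posDef he hz).det_pos

theorem contDiffOn_comp_symm (he : e ∈ atlas (EuclideanSpace ℝ (Fin n)) M) {k : WithTop ℕ∞}
    (hk : k ≤ ∞) {u : M → ℝ} (hu : ContMDiff (𝓡 n) 𝓘(ℝ, ℝ) k u) :
    ContDiffOn ℝ k (u ∘ e.symm) e.target := by
  rw [← contMDiffOn_iff_contDiffOn]
  have h1 : ContMDiffOn (𝓡 n) (𝓡 n) ∞ e.symm e.target :=
    contMDiffOn_symm_of_mem_maximalAtlas (IsManifold.subset_maximalAtlas he)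
  exact hu.comp_contMDiffOn (h1.of_le hk)

theorem pd_comp_symm (he : e ∈ atlas (EuclideanSpace ℝ (Fin n)) M) (hy : y ∈ e.target)
    {u : M → ℝ} (hu : MDifferentiableAt (𝓡 n) 𝓘(ℝ, ℝ) u (e.symm y)) (i : Fin n) :
    Coord.pd i (u ∘ e.symm) y = mfderiv (𝓡 n) 𝓘(ℝ, ℝ) u (e.symm y) (coordVector e i y) := by
  have h := mfderiv_comp y hu ((mdifferentiable_of_mem_atlas (I := 𝓡 n) he).mdifferentiableAt_symm hy)
  rw [Coord.pd, ← mfderiv_eq_fderiv, h]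
  rfl

/-! ### The gradient -/

/-- The gradient of `u` at the point with coordinates `y`. -/
def gradVector (g : C2Metric n M) (e : OpenPartialHomeomorph M (EuclideanSpace ℝ (Fin n)))
    (u : M → ℝ) (y : EuclideanSpace ℝ (Fin n)) : TangentSpace (𝓡 n) (e.symm y) :=
  ∑ k, Coord.grad (metricCoeff g e) (u ∘ e.symm) k y • coordVector e k y

theorem inner_gradVector (he : e ∈ atlas (EuclideanSpace ℝ (Fin n)) M) (hy : y ∈ e.target)
    {u : M → ℝ} (hu : MDifferentiableAt (𝓡 n) 𝓘(ℝ, ℝ) u (e.symm y))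
    (w : TangentSpace (𝓡 n) (e.symm y)) :
    g.inner (e.symm y) (gradVector g e u y) w = mfderiv (𝓡 n) 𝓘(ℝ, ℝ) u (e.symm y) w := by
  obtain ⟨v, rfl⟩ := exists_eq_sum_coordVector he hy w
  have h := metricCoeff_quadratic (g := g) (e := e) (y := y)
    (WithLp.toLp 2 fun k => Coord.grad (metricCoeff g e) (u ∘ e.symm) k y) v
  refine h.symm.trans ?_
  rw [Finset.sum_comm]
  have hG := metricOn_metricCoeff g he
  have h2 : ∀ j, ∑ i, Coord.grad (metricCoeff g e) (u ∘ e.symm) i y * metricCoeff g e y i j =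
      Coord.pd j (u ∘ e.symm) y := fun j => by
    rw [← hG.sum_mul_grad hy]
    exact Finset.sum_congr rfl fun i _ => by rw [hG.symm y hy i j, mul_comm]
  simp only [← Finset.sum_mul, h2]
  erw [map_sum]
  refine Finset.sum_congr rfl fun j _ => ?_
  erw [map_smul]
  rw [pd_comp_symm he hy hu]
  exact mul_comm (_ : ℝ) _

theorem C2Metric.eq_of_inner_eq {x : M} {X Y : TangentSpace (𝓡 n) x}
    (h : ∀ w, g.inner x X w = g.inner x Y w) : X = Y := by
  by_contra hne
  have := g.pos x (X - Y) (sub_ne_zero.2 hne)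
  simp [h] at this

/-- The vector `X` represents the differential of `u` at `x`. -/
def IsRiemGradient (g : C2Metric n M) (u : M → ℝ) (x : M) (X : TangentSpace (𝓡 n) x) : Prop :=
  ∀ w, g.inner x X w = mfderiv (𝓡 n) 𝓘(ℝ, ℝ) u x w

theorem exists_chart_point (x : M) : ∃ e ∈ atlas (EuclideanSpace ℝ (Fin n)) M,
    ∃ y ∈ e.target, e.symm y = x :=
  ⟨chartAt _ x, chart_mem_atlas _ x, chartAt _ x x, mem_chart_target _ x,
    (chartAt _ x).left_inv (mem_chart_source _ x)⟩

theorem exists_isRiemGradient (g : C2Metric n M) {u : M → ℝ} {x : M}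
    (hu : MDifferentiableAt (𝓡 n) 𝓘(ℝ, ℝ) u x) : ∃ X, IsRiemGradient g u x X := by
  obtain ⟨e, he, y, hy, rfl⟩ := exists_chart_point (n := n) x
  exact ⟨_, inner_gradVector he hy hu⟩

/-- The gradient of `u`, equal to zero where `u` is not differentiable. -/
def riemGradient (g : C2Metric n M) (u : M → ℝ) (x : M) : TangentSpace (𝓡 n) x :=
  open Classical in if h : ∃ X, IsRiemGradient g u x X then h.choose else 0

theorem isRiemGradient_riemGradient (g : C2Metric n M) {u : M → ℝ} {x : M}
    (hu : MDifferentiableAt (𝓡 n) 𝓘(ℝ, ℝ) u x) : IsRiemGradient g u x (riemGradient g u x) := by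
  have h := exists_isRiemGradient g hu
  rw [riemGradient, dif_pos h]
  exact h.choose_spec

theorem riemGradient_eq_gradVector (he : e ∈ atlas (EuclideanSpace ℝ (Fin n)) M) (hy : y ∈ e.target)
    {u : M → ℝ} (hu : MDifferentiableAt (𝓡 n) 𝓘(ℝ, ℝ) u (e.symm y)) :
    riemGradient g u (e.symm y) = gradVector g e u y :=
  C2Metric.eq_of_inner_eq (g := g) fun w =>
    (isRiemGradient_riemGradient g hu w).trans (inner_gradVector he hy hu w).symm

/-- The inner product `⟨dv, du⟩` of two differentials. -/
def dirichlet (g : C2Metric n M) (v u : M → ℝ) (x : M) : ℝ :=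
  show ℝ from mfderiv (𝓡 n) 𝓘(ℝ, ℝ) v x (riemGradient g u x)

theorem dirichlet_comp_symm (he : e ∈ atlas (EuclideanSpace ℝ (Fin n)) M) (hy : y ∈ e.target)
    {u v : M → ℝ} (hu : MDifferentiableAt (𝓡 n) 𝓘(ℝ, ℝ) u (e.symm y))
    (hv : MDifferentiableAt (𝓡 n) 𝓘(ℝ, ℝ) v (e.symm y)) :
    dirichlet g v u (e.symm y) = ∑ k, Coord.pd k (v ∘ e.symm) y *
      Coord.grad (metricCoeff g e) (u ∘ e.symm) k y := by
  rw [dirichlet, riemGradient_eq_gradVector he hy hu, gradVector]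
  erw [map_sum]
  refine Finset.sum_congr rfl fun k _ => ?_
  erw [map_smul]
  rw [pd_comp_symm he hy hv]
  exact mul_comm (_ : ℝ) _

theorem dirichlet_self_nonneg {u : M → ℝ} {x : M}
    (hu : MDifferentiableAt (𝓡 n) 𝓘(ℝ, ℝ) u x) : 0 ≤ dirichlet g u u x := by
  have h : g.inner x (riemGradient g u x) (riemGradient g u x) = dirichlet g u u x :=
    isRiemGradient_riemGradient g hu _
  rw [← h]
  by_cases h0 : riemGradient g u x = 0
  · simp [h0]
  · exact (g.pos x _ h0).le

theorem dirichlet_self_le {u : M → ℝ} {x : M} {ε : ℝ}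
    (hu : MDifferentiableAt (𝓡 n) 𝓘(ℝ, ℝ) u x)
    (hbound : ∀ w : TangentSpace (𝓡 n) x,
      |(show ℝ from mfderiv (𝓡 n) 𝓘(ℝ, ℝ) u x w)| ≤ ε * √(g.inner x w w)) :
    dirichlet g u u x ≤ ε ^ 2 := by
  have h : g.inner x (riemGradient g u x) (riemGradient g u x) = dirichlet g u u x :=
    isRiemGradient_riemGradient g hu _
  have h0 := dirichlet_self_nonneg (g := g) hu
  have h1 : dirichlet g u u x ≤ ε * √(dirichlet g u u x) := by
    have := hbound (riemGradient g u x)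
    rw [h] at this
    exact (le_abs_self _).trans this
  -- With s the square root of the energy, s² ≤ εs and 2εs ≤ s² + ε² give s² ≤ ε², whatever the sign
  -- of `ε`.
  nlinarith [Real.sq_sqrt h0, Real.sqrt_nonneg (dirichlet g u u x),
    sq_nonneg (√(dirichlet g u u x) - ε)]

end Manifold

section Manifold

variable {n : ℕ} {M : Type*} [TopologicalSpace M] [ChartedSpace (EuclideanSpace ℝ (Fin n)) M]
  [IsManifold (𝓡 n) ∞ M]

variable {e e' : OpenPartialHomeomorph M (EuclideanSpace ℝ (Fin n))}
  {y : EuclideanSpace ℝ (Fin n)} {g : C2Metric n M}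

/-! ### Change of charts -/

theorem differentiableAt_transition (he : e ∈ atlas (EuclideanSpace ℝ (Fin n)) M)
    (he' : e' ∈ atlas (EuclideanSpace ℝ (Fin n)) M) (hy : y ∈ e.target)
    (hy' : e.symm y ∈ e'.source) : DifferentiableAt ℝ (e' ∘ e.symm) y := by
  rw [← mdifferentiableAt_iff_differentiableAt]
  exact ((mdifferentiable_of_mem_atlas (I := 𝓡 n) he').mdifferentiableAt hy').comp y
    ((mdifferentiable_of_mem_atlas (I := 𝓡 n) he).mdifferentiableAt_symm hy)

/-- All tangent spaces unfold to the model space. This transports an inner product along an equality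
of base points, such as that between the two chart expressions of one point. -/
theorem C2Metric.inner_congr {x x' : M} (h : x = x') (v w : EuclideanSpace ℝ (Fin n)) :
    g.inner x (show TangentSpace (𝓡 n) x from v) (show TangentSpace (𝓡 n) x from w) =
      g.inner x' (show TangentSpace (𝓡 n) x' from v) (show TangentSpace (𝓡 n) x' from w) := by
  subst h; rfl

theorem metricCoeff_transition (he : e ∈ atlas (EuclideanSpace ℝ (Fin n)) M)
    (he' : e' ∈ atlas (EuclideanSpace ℝ (Fin n)) M) (hy : y ∈ e.target)
    (hy' : e.symm y ∈ e'.source) :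
    metricCoeff g e y =
      (LinearMap.toMatrix (EuclideanSpace.basisFun (Fin n) ℝ).toBasis
        (EuclideanSpace.basisFun (Fin n) ℝ).toBasis
        (fderiv ℝ (e' ∘ e.symm) y : EuclideanSpace ℝ (Fin n) →ₗ[ℝ] _)).transpose *
      metricCoeff g e' (e' (e.symm y)) *
      LinearMap.toMatrix (EuclideanSpace.basisFun (Fin n) ℝ).toBasis
        (EuclideanSpace.basisFun (Fin n) ℝ).toBasis
        (fderiv ℝ (e' ∘ e.symm) y : EuclideanSpace ℝ (Fin n) →ₗ[ℝ] _) := by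
  set τ := e' ∘ e.symm with hτ
  have hyt : τ y ∈ e'.target := e'.map_source hy'
  have hdτ := differentiableAt_transition he he' hy hy'
  -- The two parametrisations differ by the transition map near `y`, so the chain rule relates their
  -- coordinate vectors.
  have hev : e'.symm ∘ τ =ᶠ[𝓝 y] e.symm := by
    filter_upwards [(e.continuousAt_symm hy).preimage_mem_nhds
      (e'.open_source.mem_nhds hy')] with z hz
    exact e'.left_inv hz
  have hd : ∀ v : EuclideanSpace ℝ (Fin n),
      (show EuclideanSpace ℝ (Fin n) from mfderiv 𝓘(ℝ, EuclideanSpace ℝ (Fin n)) (𝓡 n) e.symm y v) =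
      (show EuclideanSpace ℝ (Fin n) from mfderiv 𝓘(ℝ, EuclideanSpace ℝ (Fin n)) (𝓡 n)
        e'.symm (τ y) (fderiv ℝ τ y v)) := by
    intro v
    have h1 := mfderiv_comp (I := 𝓘(ℝ, EuclideanSpace ℝ (Fin n)))
      (I' := 𝓘(ℝ, EuclideanSpace ℝ (Fin n))) (I'' := 𝓡 n) y
      ((mdifferentiable_of_mem_atlas (I := 𝓡 n) he').mdifferentiableAt_symm hyt)
      hdτ.mdifferentiableAt
    have h2 := hev.mfderiv_eq (I := 𝓘(ℝ, EuclideanSpace ℝ (Fin n))) (I' := 𝓡 n)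
    rw [mfderiv_eq_fderiv] at h1
    exact (congrArg (fun L : EuclideanSpace ℝ (Fin n) →L[ℝ] EuclideanSpace ℝ (Fin n) => L v)
      (h2.symm.trans h1))
  have hx : e.symm y = e'.symm (τ y) := hev.eq_of_nhds.symm
  ext i j
  have hent : ∀ k l, LinearMap.toMatrix (EuclideanSpace.basisFun (Fin n) ℝ).toBasis
      (EuclideanSpace.basisFun (Fin n) ℝ).toBasis
      (fderiv ℝ τ y : EuclideanSpace ℝ (Fin n) →ₗ[ℝ] _) k l =
      (fderiv ℝ τ y (EuclideanSpace.single l 1)) k := by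
    intro k l
    simp [LinearMap.toMatrix_apply]
  have h3 := metricCoeff_quadratic (g := g) (e := e') (y := τ y)
    (fderiv ℝ τ y (EuclideanSpace.single i 1)) (fderiv ℝ τ y (EuclideanSpace.single j 1))
  rw [sum_smul_coordVector, sum_smul_coordVector] at h3
  have h4 : metricCoeff g e y i j = ∑ k, ∑ l, (fderiv ℝ τ y (EuclideanSpace.single i 1)) k *
      metricCoeff g e' (τ y) k l * (fderiv ℝ τ y (EuclideanSpace.single j 1)) l := by
    rw [h3]
    refine Eq.trans ?_ (C2Metric.inner_congr (g := g) hx _ _)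
    rw [← hd, ← hd]
    rfl
  rw [h4]
  simp only [Matrix.mul_apply, Matrix.transpose_apply, hent, Finset.sum_mul]
  rw [Finset.sum_comm]
  rfl

theorem sqrt_det_metricCoeff_transition (he : e ∈ atlas (EuclideanSpace ℝ (Fin n)) M)
    (he' : e' ∈ atlas (EuclideanSpace ℝ (Fin n)) M) (hy : y ∈ e.target)
    (hy' : e.symm y ∈ e'.source) :
    √(metricCoeff g e y).det =
      |(fderiv ℝ (e' ∘ e.symm) y).det| * √(metricCoeff g e' (e' (e.symm y))).det := by
  rw [metricCoeff_transition he he' hy hy', Matrix.det_mul, Matrix.det_mul, Matrix.det_transpose,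
    LinearMap.det_toMatrix, mul_right_comm, Real.sqrt_mul (mul_self_nonneg _),
    Real.sqrt_mul_self_eq_abs]

/-! ### The Riemannian volume in charts -/

variable [MeasurableSpace M] [BorelSpace M]

theorem OpenPartialHomeomorph.measurableSet_target_inter
    (e : OpenPartialHomeomorph M (EuclideanSpace ℝ (Fin n))) {A : Set M} (hA : MeasurableSet A) :
    MeasurableSet (e.target ∩ e.symm ⁻¹' A) := by
  have h : Measurable (e.target.domRestrict e.symm) :=
    (continuousOn_iff_continuous_domRestrict.1 e.continuousOn_symm).measurable
  convert e.open_target.measurableSet.subtype_image (h hA) using 1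
  ext z
  simp [and_comm]

theorem OpenPartialHomeomorph.aemeasurable_symm
    (e : OpenPartialHomeomorph M (EuclideanSpace ℝ (Fin n))) :
    AEMeasurable e.symm (volume.restrict e.target) :=
  e.continuousOn_symm.aemeasurable e.open_target.measurableSet

theorem continuousOn_sqrt_det (g : C2Metric n M) (he : e ∈ atlas (EuclideanSpace ℝ (Fin n)) M) :
    ContinuousOn (fun y => √(metricCoeff g e y).det) e.target :=
  (ContDiffOn.matrix_det (metricOn_metricCoeff g he).contDiffOn).continuousOn.sqrt

theorem aemeasurable_density (g : C2Metric n M) (he : e ∈ atlas (EuclideanSpace ℝ (Fin n)) M) :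
    AEMeasurable (fun y => ENNReal.ofReal √(metricCoeff g e y).det)
      (volume.restrict e.target) :=
  ((continuousOn_sqrt_det g he).aemeasurable e.open_target.measurableSet).ennreal_ofReal

theorem chartVolume_apply (g : C2Metric n M)
    (e : OpenPartialHomeomorph M (EuclideanSpace ℝ (Fin n))) {A : Set M} (hA : MeasurableSet A) :
    chartVolume g e A = ∫⁻ y in e.target ∩ e.symm ⁻¹' A,
      ENNReal.ofReal √(metricCoeff g e y).det := by
  rw [chartVolume, Measure.map_apply_of_aemeasurable
    (e.aemeasurable_symm.mono_ac (withDensity_absolutelyContinuous _ _)) hA,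
    withDensity_apply', Measure.restrict_restrict' e.open_target.measurableSet, Set.inter_comm]

theorem lintegral_chartVolume (g : C2Metric n M) (he : e ∈ atlas (EuclideanSpace ℝ (Fin n)) M)
    {f : M → ENNReal} (hf : Measurable f) :
    ∫⁻ x, f x ∂chartVolume g e = ∫⁻ y in e.target,
      ENNReal.ofReal √(metricCoeff g e y).det * f (e.symm y) := by
  rw [chartVolume, lintegral_map' hf.aemeasurable
    (e.aemeasurable_symm.mono_ac (withDensity_absolutelyContinuous _ _)),
    lintegral_withDensity_eq_lintegral_mul₀ (g := fun y => f (e.symm y))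
      (aemeasurable_density g he) (hf.comp_aemeasurable e.aemeasurable_symm)]
  rfl

theorem integral_chartVolume (g : C2Metric n M) (he : e ∈ atlas (EuclideanSpace ℝ (Fin n)) M)
    {f : M → ℝ} (hf : AEStronglyMeasurable f (chartVolume g e)) :
    ∫ x, f x ∂chartVolume g e = ∫ y in e.target, √(metricCoeff g e y).det * f (e.symm y) := by
  rw [chartVolume, integral_map
    (e.aemeasurable_symm.mono_ac (withDensity_absolutelyContinuous _ _)) hf]
  have := integral_withDensity_eq_integral_smul₀ (μ := volume.restrict e.target)
    (f := fun y => Real.toNNReal √(metricCoeff g e y).det)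
    ((continuousOn_sqrt_det g he).aemeasurable e.open_target.measurableSet).real_toNNReal
    (fun y => f (e.symm y))
  refine this.trans (integral_congr_ae (Filter.Eventually.of_forall fun y => ?_))
  simp [NNReal.smul_def]

/-- Change of variables along the transition map: its Jacobian is exactly the ratio of the two
densities, by `sqrt_det_metricCoeff_transition`. -/
theorem chartVolume_apply_eq (he : e ∈ atlas (EuclideanSpace ℝ (Fin n)) M)
    (he' : e' ∈ atlas (EuclideanSpace ℝ (Fin n)) M) {A : Set M} (hA : MeasurableSet A)
    (hAe : A ⊆ e.source) (hAe' : A ⊆ e'.source) : chartVolume g e A = chartVolume g e' A := by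
  rw [chartVolume_apply g e hA, chartVolume_apply g e' hA]
  have himage : e'.target ∩ e'.symm ⁻¹' A = (e' ∘ e.symm) '' (e.target ∩ e.symm ⁻¹' A) := by
    ext z
    constructor
    · rintro ⟨hz, hzA⟩
      refine ⟨e (e'.symm z), ⟨e.map_source (hAe hzA), ?_⟩, ?_⟩
      · simpa [e.left_inv (hAe hzA)] using hzA
      · simp [e.left_inv (hAe hzA), e'.right_inv hz]
    · rintro ⟨y, ⟨-, hyA⟩, rfl⟩
      exact ⟨e'.map_source (hAe' hyA), by simpa [e'.left_inv (hAe' hyA)] using hyA⟩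
  have hinj : Set.InjOn (e' ∘ e.symm) (e.target ∩ e.symm ⁻¹' A) := by
    rintro y ⟨hy, hyA⟩ z ⟨hz, hzA⟩ hyz
    exact e.symm.injOn hy hz (e'.injOn (hAe' hyA) (hAe' hzA) hyz)
  rw [himage, lintegral_image_eq_lintegral_abs_det_fderiv_mul volume
    (e.measurableSet_target_inter hA)
    (fun y hy => (differentiableAt_transition he he' hy.1
      (hAe' hy.2)).hasFDerivAt.hasFDerivWithinAt) hinj]
  refine setLIntegral_congr_fun (e.measurableSet_target_inter hA) fun y hy => ?_
  simp only [sqrt_det_metricCoeff_transition he he' hy.1 (hAe' hy.2)]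
  rw [ENNReal.ofReal_mul (abs_nonneg _)]
  rfl

theorem chartVolume_compl_source (g : C2Metric n M)
    (e : OpenPartialHomeomorph M (EuclideanSpace ℝ (Fin n))) :
    chartVolume g e e.sourceᶜ = 0 := by
  rw [chartVolume_apply g e e.open_source.measurableSet.compl]
  have : e.target ∩ e.symm ⁻¹' e.sourceᶜ = ∅ := by
    ext z
    simp only [Set.mem_inter_iff, Set.mem_preimage, Set.mem_compl_iff, Set.mem_empty_iff_false,
      iff_false, not_and, not_not]
    exact fun hz => e.map_target hz
  rw [this, Measure.restrict_empty, lintegral_zero_measure]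

variable [SecondCountableTopology M] [Nonempty M]

theorem chartSeq_mem_atlas (k : ℕ) : chartSeq n M k ∈ atlas (EuclideanSpace ℝ (Fin n)) M :=
  chart_mem_atlas _ _

theorem iUnion_chartSeq_source : ⋃ k, (chartSeq n M k).source = Set.univ :=
  (exists_chart_cover n M).choose_spec

theorem measurableSet_disjointed_chartSeq (k : ℕ) :
    MeasurableSet (disjointed (fun j => (chartSeq n M j).source) k) :=
  MeasurableSet.disjointed (fun j => (chartSeq n M j).open_source.measurableSet) k

/-- On each disjoint piece the volume of the selected chart agrees with that of `e`, and the pieces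
exhaust `M`. -/
theorem riemannianVolume_restrict_source (g : C2Metric n M)
    (he : e ∈ atlas (EuclideanSpace ℝ (Fin n)) M) :
    (riemannianVolume g).restrict e.source = chartVolume g e := by
  have hS := e.open_source.measurableSet
  set D := disjointed (fun j => (chartSeq n M j).source) with hD
  have hDm : ∀ k, MeasurableSet (D k) := measurableSet_disjointed_chartSeq
  have hDs : ∀ k, D k ⊆ (chartSeq n M k).source := fun k => disjointed_subset _ k
  have h1 : ∀ k, ((chartVolume g (chartSeq n M k)).restrict (D k)).restrict e.source =
      (chartVolume g e).restrict (D k) := by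
    intro k
    ext A hA
    rw [Measure.restrict_apply hA, Measure.restrict_apply (hA.inter hS), Measure.restrict_apply hA,
      chartVolume_apply_eq (chartSeq_mem_atlas k) he ((hA.inter hS).inter (hDm k))
        (fun x hx => hDs k hx.2) (fun x hx => hx.1.2)]
    refine measure_congr ?_
    have : ∀ᵐ x ∂chartVolume g e, x ∈ e.source := by
      rw [ae_iff]; exact chartVolume_compl_source g e
    filter_upwards [this] with x hx
    exact propext ⟨fun h => ⟨h.1.1, h.2⟩, fun h => ⟨⟨h.1, hx⟩, h.2⟩⟩
  rw [riemannianVolume, Measure.restrict_sum _ hS]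
  simp only [← hD, h1]
  rw [← Measure.restrict_iUnion (disjoint_disjointed _) hDm, iUnion_disjointed,
    iUnion_chartSeq_source, Measure.restrict_univ]

theorem exists_nhds_riemannianVolume_lt_top (g : C2Metric n M) (x : M) :
    ∃ N ∈ 𝓝 x, riemannianVolume g N < ⊤ := by
  obtain ⟨e, he, y, hy, rfl⟩ := exists_chart_point (n := n) x
  obtain ⟨K, hKn, hKe, hK⟩ := local_compact_nhds (e.open_target.mem_nhds hy)
  refine ⟨e.source ∩ e ⁻¹' interior K, ?_, ?_⟩
  · have hx := e.map_target hy
    refine Filter.inter_mem (e.open_source.mem_nhds hx) ((e.continuousAt hx).preimage_mem_nhds ?_)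
    rw [e.right_inv hy]
    exact interior_mem_nhds.2 hKn
  · have hopen : IsOpen (e.source ∩ e ⁻¹' interior K) :=
      e.isOpen_inter_preimage isOpen_interior
    have h1 : riemannianVolume g (e.source ∩ e ⁻¹' interior K) =
        chartVolume g e (e.source ∩ e ⁻¹' interior K) := by
      rw [← riemannianVolume_restrict_source g he, Measure.restrict_apply hopen.measurableSet]
      congr 1
      ext; simp; tauto
    rw [h1, chartVolume_apply g e hopen.measurableSet]
    have hsub : e.target ∩ e.symm ⁻¹' (e.source ∩ e ⁻¹' interior K) ⊆ K := by
      rintro z ⟨hz, -, hzK⟩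
      have : e (e.symm z) ∈ interior K := hzK
      rw [e.right_inv hz] at this
      exact interior_subset this
    refine (lintegral_mono_set hsub).trans_lt ?_
    have := ((continuousOn_sqrt_det g he).mono hKe).integrableOn_compact (μ := volume) hK
    exact this.lintegral_lt_top

theorem isLocallyFiniteMeasure_riemannianVolume (g : C2Metric n M) :
    IsLocallyFiniteMeasure (riemannianVolume g) :=
  ⟨fun x => exists_nhds_riemannianVolume_lt_top g x⟩

theorem isOpenPosMeasure_riemannianVolume (g : C2Metric n M) :
    (riemannianVolume g).IsOpenPosMeasure := by
  refine ⟨fun U hU hne h0 => ?_⟩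
  obtain ⟨x, hx⟩ := hne
  obtain ⟨e, he, y, hy, rfl⟩ := exists_chart_point (n := n) x
  have h1 : chartVolume g e U = 0 := by
    rw [← riemannianVolume_restrict_source g he]
    exact le_antisymm ((Measure.restrict_apply_le _ _).trans h0.le) bot_le
  rw [chartVolume_apply g e hU.measurableSet] at h1
  have hV : IsOpen (e.target ∩ e.symm ⁻¹' U) := e.symm.isOpen_inter_preimage hU
  rw [setLIntegral_eq_zero_iff' hV.measurableSet
    ((aemeasurable_density g he).mono_set Set.inter_subset_left)] at h1
  have h2 : volume (e.target ∩ e.symm ⁻¹' U) = 0 := by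
    refine measure_mono_null ?_ (ae_iff.1 h1)
    intro z hz
    simp only [Set.mem_ofPred_eq, Classical.not_imp]
    refine ⟨hz, ?_⟩
    simpa using (metricOn_metricCoeff g he).det_pos z hz.1
  exact (hV.measure_pos volume ⟨y, hy, hx⟩).ne' h2

/-- The determinant is homogeneous of degree `n`, so the coefficients' factor `u ^ p` becomes `u ^
(p * n)`, and the square root halves the exponent. -/
theorem chartVolume_conformal (he : e ∈ atlas (EuclideanSpace ℝ (Fin n)) M) {u : M → ℝ}
    (hu : ContMDiff (𝓡 n) 𝓘(ℝ, ℝ) 2 u) (hpos : ∀ x, 0 < u x) (p : ℝ) :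
    chartVolume (g.conformal u hu hpos p) e =
      (chartVolume g e).withDensity fun x => ENNReal.ofReal (u x ^ (p * n / 2)) := by
  have hcoeff : ∀ y, metricCoeff (g.conformal u hu hpos p) e y =
      u (e.symm y) ^ p • metricCoeff g e y := fun y => by
    ext i j; rfl
  have hw : Measurable fun x => ENNReal.ofReal (u x ^ (p * n / 2)) :=
    (hu.continuous.measurable.pow_const _).ennreal_ofReal
  ext A hA
  rw [chartVolume_apply _ _ hA, withDensity_apply _ hA, ← lintegral_indicator hA,
    lintegral_chartVolume g he (hw.indicator hA)]
  rw [← lintegral_indicator (e.measurableSet_target_inter hA),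
    ← lintegral_indicator e.open_target.measurableSet]
  refine lintegral_congr fun y => ?_
  by_cases hy : y ∈ e.target
  · by_cases hyA : e.symm y ∈ A
    · have hup := hpos (e.symm y)
      rw [Set.indicator_of_mem (show y ∈ e.target ∩ e.symm ⁻¹' A from ⟨hy, hyA⟩),
        Set.indicator_of_mem hy, Set.indicator_of_mem hyA, hcoeff, Matrix.det_smul,
        Fintype.card_fin, Real.sqrt_mul (by positivity),
        ENNReal.ofReal_mul (Real.sqrt_nonneg _), mul_comm]
      congr 2
      rw [Real.sqrt_eq_rpow, ← Real.rpow_natCast, ← Real.rpow_mul hup.le, ← Real.rpow_mul hup.le]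
      congr 1
      ring
    · rw [Set.indicator_of_notMem (fun h => hyA h.2), Set.indicator_of_mem hy,
        Set.indicator_of_notMem hyA, mul_zero]
  · rw [Set.indicator_of_notMem (fun h => hy h.1), Set.indicator_of_notMem hy]

theorem riemannianVolume_conformal (g : C2Metric n M) {u : M → ℝ}
    (hu : ContMDiff (𝓡 n) 𝓘(ℝ, ℝ) 2 u) (hpos : ∀ x, 0 < u x) (p : ℝ) :
    riemannianVolume (g.conformal u hu hpos p) =
      (riemannianVolume g).withDensity fun x => ENNReal.ofReal (u x ^ (p * n / 2)) := by
  rw [riemannianVolume, riemannianVolume, withDensity_sum]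
  congr 1
  ext1 k
  rw [chartVolume_conformal (chartSeq_mem_atlas k) hu hpos p,
    restrict_withDensity (measurableSet_disjointed_chartSeq k)]

end Manifold

section Manifold

variable {n : ℕ} {M : Type*} [TopologicalSpace M] [ChartedSpace (EuclideanSpace ℝ (Fin n)) M]
  [IsManifold (𝓡 n) ∞ M]

variable {e e' : OpenPartialHomeomorph M (EuclideanSpace ℝ (Fin n))}
  {y : EuclideanSpace ℝ (Fin n)} {g : C2Metric n M} {u v : M → ℝ}

/-! ### The Laplacian -/

/-- The Laplacian of `u`, computed in the chart `e`. -/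
def chartLaplacian (g : C2Metric n M) (e : OpenPartialHomeomorph M (EuclideanSpace ℝ (Fin n)))
    (u : M → ℝ) (x : M) : ℝ :=
  Coord.lap (metricCoeff g e) (u ∘ e.symm) (e x)

/-- The Laplacian of `u`, computed at each point in the preferred chart. -/
def laplacian (g : C2Metric n M) (u : M → ℝ) (x : M) : ℝ :=
  chartLaplacian g (chartAt (EuclideanSpace ℝ (Fin n)) x) u x

theorem chartLaplacian_eq_zero_of_eventuallyEq_const
    {x : M} {c : ℝ} (hx : x ∈ e.source) (h : u =ᶠ[𝓝 x] fun _ => c) :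
    chartLaplacian g e u x = 0 := by
  have h0 : ∀ᶠ z in 𝓝 (e.symm (e x)), u z = c := by rwa [e.left_inv hx]
  have h1 : u ∘ e.symm =ᶠ[𝓝 (e x)] fun _ => c :=
    (e.continuousAt_symm (e.map_source hx)).eventually h0
  rw [chartLaplacian, Coord.lap_congr h1, Coord.lap_const]

theorem continuousOn_chartLaplacian (g : C2Metric n M)
    (he : e ∈ atlas (EuclideanSpace ℝ (Fin n)) M) (hu : ContMDiff (𝓡 n) 𝓘(ℝ, ℝ) 2 u) :
    ContinuousOn (chartLaplacian g e u) e.source :=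
  ((metricOn_metricCoeff g he).continuousOn_lap (contDiffOn_comp_symm he (by decide) hu)).comp
    e.continuousOn fun _ hx => e.map_source hx

theorem dirichlet_eq_sum (he : e ∈ atlas (EuclideanSpace ℝ (Fin n)) M) {x : M} (hx : x ∈ e.source)
    (hu : MDifferentiable (𝓡 n) 𝓘(ℝ, ℝ) u) (hv : MDifferentiable (𝓡 n) 𝓘(ℝ, ℝ) v) :
    dirichlet g v u x = ∑ k, Coord.pd k (v ∘ e.symm) (e x) *
      Coord.grad (metricCoeff g e) (u ∘ e.symm) k (e x) := by
  rw [← dirichlet_comp_symm he (e.map_source hx) (hu _) (hv _), e.left_inv hx]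

theorem dirichlet_eq_zero_of_eventuallyEq_const {x : M} {c : ℝ} (h : v =ᶠ[𝓝 x] fun _ => c) :
    dirichlet g v u x = 0 := by
  rw [dirichlet, h.mfderiv_eq, mfderiv_const]
  rfl

theorem continuous_dirichlet (g : C2Metric n M) (hu : ContMDiff (𝓡 n) 𝓘(ℝ, ℝ) 2 u)
    (hv : ContMDiff (𝓡 n) 𝓘(ℝ, ℝ) 1 v) : Continuous (dirichlet g v u) := by
  rw [continuous_iff_continuousAt]
  intro x
  set e := chartAt (EuclideanSpace ℝ (Fin n)) x with he_def
  have he : e ∈ atlas (EuclideanSpace ℝ (Fin n)) M := chart_mem_atlas _ x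
  have hc : ContinuousOn (fun x => ∑ k, Coord.pd k (v ∘ e.symm) (e x) *
      Coord.grad (metricCoeff g e) (u ∘ e.symm) k (e x)) e.source := by
    refine continuousOn_finsetSum _ fun k _ => ContinuousOn.mul ?_ ?_
    · exact (Coord.contDiffOn_pd (m := 0) e.open_target (by norm_num)
        (contDiffOn_comp_symm he (by decide) hv) k).continuousOn.comp e.continuousOn
        fun _ hx => e.map_source hx
    · exact ((metricOn_metricCoeff g he).contDiffOn_grad (k := 0) (by norm_num)
        (contDiffOn_comp_symm he (by decide) hu) k).continuousOn.comp e.continuousOn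
        fun _ hx => e.map_source hx
  have hx : e.source ∈ 𝓝 x := e.open_source.mem_nhds (mem_chart_source _ x)
  refine (hc.continuousAt hx).congr (Filter.eventually_of_mem hx fun z hz => ?_)
  exact (dirichlet_eq_sum he hz (hu.mdifferentiable (by norm_num))
    (hv.mdifferentiable (by norm_num))).symm

variable [MeasurableSpace M] [BorelSpace M] [SecondCountableTopology M] [Nonempty M]

/-- The right-hand side does not mention the chart, which is what later forces the Laplacian to be
chart independent. -/
theorem integral_mul_chartLaplacian (g : C2Metric n M)
    (he : e ∈ atlas (EuclideanSpace ℝ (Fin n)) M) (hu : ContMDiff (𝓡 n) 𝓘(ℝ, ℝ) 2 u)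
    (hv : ContMDiff (𝓡 n) 𝓘(ℝ, ℝ) 1 v) (hvc : HasCompactSupport v) (hve : tsupport v ⊆ e.source) :
    ∫ x, v x * chartLaplacian g e u x ∂riemannianVolume g =
      -∫ x, dirichlet g v u x ∂riemannianVolume g := by
  have hS := e.open_source.measurableSet
  have hv0 : ∀ x, x ∉ e.source → v =ᶠ[𝓝 x] fun _ => 0 := fun x hx =>
    notMem_tsupport_iff_eventuallyEq.1 fun h => hx (hve h)
  rw [← setIntegral_eq_integral_of_forall_compl_eq_zero (s := e.source) (fun x hx => by
      rw [(hv0 x hx).eq_of_nhds, zero_mul]),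
    ← setIntegral_eq_integral_of_forall_compl_eq_zero (s := e.source) (fun x hx =>
      dirichlet_eq_zero_of_eventuallyEq_const (hv0 x hx))]
  have hm1 : AEStronglyMeasurable (fun x => v x * chartLaplacian g e u x) (chartVolume g e) := by
    rw [← riemannianVolume_restrict_source g he]
    exact (hv.continuous.continuousOn.mul
      (continuousOn_chartLaplacian g he hu)).aestronglyMeasurable hS
  have hm2 : AEStronglyMeasurable (dirichlet g v u) (chartVolume g e) := by
    rw [← riemannianVolume_restrict_source g he]
    exact (continuous_dirichlet g hu hv).continuousOn.aestronglyMeasurable hS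
  rw [riemannianVolume_restrict_source g he, integral_chartVolume g he hm1,
    integral_chartVolume g he hm2]
  have hT := e.open_target.measurableSet
  have hibp := (metricOn_metricCoeff g he).integral_mul_lap (f := u ∘ e.symm) (h := v ∘ e.symm)
    (K := e '' tsupport v) (contDiffOn_comp_symm he (by decide) hu)
    (contDiffOn_comp_symm he (by decide) hv)
    (hvc.isCompact.image_of_continuousOn (e.continuousOn.mono hve))
    (by rintro _ ⟨x, hx, rfl⟩; exact e.map_source (hve hx))
    (fun z hz hzK => image_eq_zero_of_notMem_tsupport (f := v) fun h =>
      hzK ⟨e.symm z, h, e.right_inv hz⟩)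
  refine Eq.trans (setIntegral_congr_fun hT fun z hz => ?_) (hibp.trans ?_)
  · simp only [chartLaplacian, e.right_inv hz, Function.comp_apply]
  · congr 1
    refine setIntegral_congr_fun hT fun z hz => ?_
    rw [dirichlet_comp_symm he hz (hu.mdifferentiable (by norm_num) _)
      (hv.mdifferentiable (by norm_num) _)]

variable [T2Space M]

/-- The Laplacian does not depend on the chart. -/
theorem chartLaplacian_eq (g : C2Metric n M) (he : e ∈ atlas (EuclideanSpace ℝ (Fin n)) M)
    (he' : e' ∈ atlas (EuclideanSpace ℝ (Fin n)) M) (hu : ContMDiff (𝓡 n) 𝓘(ℝ, ℝ) 2 u)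
    {x : M} (hx : x ∈ e.source) (hx' : x ∈ e'.source) :
    chartLaplacian g e u x = chartLaplacian g e' u x := by
  have : LocallyCompactSpace M := ChartedSpace.locallyCompactSpace (EuclideanSpace ℝ (Fin n)) M
  have := isLocallyFiniteMeasure_riemannianVolume g
  have := isOpenPosMeasure_riemannianVolume g
  set U := e.source ∩ e'.source with hU_def
  have hU : IsOpen U := e.open_source.inter e'.open_source
  have hc : ContinuousOn (chartLaplacian g e u) U :=
    (continuousOn_chartLaplacian g he hu).mono Set.inter_subset_left
  have hc' : ContinuousOn (chartLaplacian g e' u) U :=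
    (continuousOn_chartLaplacian g he' hu).mono Set.inter_subset_right
  have hint : ∀ {v w : M → ℝ}, Continuous v → HasCompactSupport v → tsupport v ⊆ U →
      ContinuousOn w U → Integrable (fun x => v x * w x) (riemannianVolume g) := by
    intro v w hv hvc hvU hw
    have h1 : IntegrableOn (fun x => v x * w x) (tsupport v) (riemannianVolume g) :=
      (hv.continuousOn.mul (hw.mono hvU)).integrableOn_compact hvc
    refine (integrableOn_iff_integrable_of_support_subset fun z hz => ?_).1 h1
    exact subset_tsupport v (left_ne_zero_of_mul hz)
  -- Against every test function supported in the overlap, both Laplacians integrate to the same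
  -- Dirichlet integral. They hence agree almost everywhere, and by continuity everywhere, since
  -- nonempty open sets have positive volume. No transformation law for Christoffel symbols is
  -- needed.
  have hae : ∀ᵐ x ∂riemannianVolume g, x ∈ U →
      chartLaplacian g e u x - chartLaplacian g e' u x = 0 := by
    refine hU.ae_eq_zero_of_integral_contMDiff_smul_eq_zero (𝓡 n)
      ((hc.sub hc').locallyIntegrableOn hU.measurableSet) fun v hv hvc hvU => ?_
    have hv1 : ContMDiff (𝓡 n) 𝓘(ℝ, ℝ) 1 v := hv.of_le (by decide)
    simp only [smul_eq_mul, mul_sub]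
    rw [integral_sub (hint hv.continuous hvc hvU hc) (hint hv.continuous hvc hvU hc'),
      integral_mul_chartLaplacian g he hu hv1 hvc (hvU.trans Set.inter_subset_left),
      integral_mul_chartLaplacian g he' hu hv1 hvc (hvU.trans Set.inter_subset_right), sub_self]
  have heq : Set.EqOn (chartLaplacian g e u) (chartLaplacian g e' u) U := by
    refine Measure.eqOn_open_of_ae_eq (μ := riemannianVolume g) ?_ hU hc hc'
    rw [Filter.EventuallyEq, ae_restrict_iff' hU.measurableSet]
    filter_upwards [hae] with z hz hzU
    exact sub_eq_zero.1 (hz hzU)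
  exact heq ⟨hx, hx'⟩

theorem laplacian_eq_chartLaplacian (g : C2Metric n M)
    (he : e ∈ atlas (EuclideanSpace ℝ (Fin n)) M) (hu : ContMDiff (𝓡 n) 𝓘(ℝ, ℝ) 2 u) {x : M}
    (hx : x ∈ e.source) : laplacian g u x = chartLaplacian g e u x :=
  chartLaplacian_eq g (chart_mem_atlas _ x) he hu (mem_chart_source _ x) hx

theorem continuous_laplacian (g : C2Metric n M) (hu : ContMDiff (𝓡 n) 𝓘(ℝ, ℝ) 2 u) :
    Continuous (laplacian g u) := by
  rw [continuous_iff_continuousAt]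
  intro x
  have hx := (chartAt (EuclideanSpace ℝ (Fin n)) x).open_source.mem_nhds (mem_chart_source _ x)
  refine ((continuousOn_chartLaplacian g (chart_mem_atlas _ x) hu).continuousAt hx).congr
    (Filter.eventually_of_mem hx fun z hz => ?_)
  exact (laplacian_eq_chartLaplacian g (chart_mem_atlas _ x) hu hz).symm

/-- Here `u` need not have compact support, but its Laplacian and differential vanish off `K`. It
can therefore be cut into pieces supported in single charts, each treated by
`integral_mul_chartLaplacian`. -/
theorem integral_mul_laplacian (g : C2Metric n M) (hu : ContMDiff (𝓡 n) 𝓘(ℝ, ℝ) 2 u)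
    {K : Set M} (hK : IsCompact K) {c : ℝ} (hc : ∀ x ∉ K, u x = c) :
    ∫ x, u x * laplacian g u x ∂riemannianVolume g =
      -∫ x, dirichlet g u u x ∂riemannianVolume g := by
  have : LocallyCompactSpace M := ChartedSpace.locallyCompactSpace (EuclideanSpace ℝ (Fin n)) M
  have := isLocallyFiniteMeasure_riemannianVolume g
  have hu1 : ContMDiff (𝓡 n) 𝓘(ℝ, ℝ) 1 u := hu.of_le (by decide)
  have huc : ∀ x ∉ K, u =ᶠ[𝓝 x] fun _ => c := fun x hx =>
    Filter.eventually_of_mem (hK.isClosed.isOpen_compl.mem_nhds hx) hc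
  -- The margin around `K` makes the partition of unity sum to one near each point of `K`, as
  -- differentiating the sum requires.
  obtain ⟨K', hK', hKK'⟩ := exists_compact_superset hK
  have hnhds : ∀ x : M, ∃ C : Set M, IsCompact C ∧ x ∈ interior C ∧
      C ⊆ (chartAt (EuclideanSpace ℝ (Fin n)) x).source := fun x =>
    exists_compact_subset (chartAt (EuclideanSpace ℝ (Fin n)) x).open_source
      (mem_chart_source _ x)
  choose C hC hxC hCs using hnhds
  obtain ⟨t, ht⟩ := hK'.elim_finite_subcover (fun x => interior (C x)) (fun _ => isOpen_interior)
    (fun x _ => Set.mem_iUnion.2 ⟨x, hxC x⟩)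
  obtain ⟨ψ, hψ⟩ := SmoothPartitionOfUnity.exists_isSubordinate (𝓡 n) hK'.isClosed
    (fun i : t => interior (C i)) (fun _ => isOpen_interior) (by simpa [Set.iUnion_subtype] using ht)
  have hsum : ∀ x ∈ K', ∑ i, ψ i x = 1 := fun x hx => by
    rw [← finsum_eq_sum_of_fintype]; exact ψ.sum_eq_one hx
  set v : t → M → ℝ := fun i x => ψ i x * u x with hv_def
  have hv : ∀ i, ContMDiff (𝓡 n) 𝓘(ℝ, ℝ) 1 (v i) := fun i =>
    ((ψ i).contMDiff.of_le (by decide)).mul hu1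
  have hts : ∀ i, tsupport (v i) ⊆ C i := fun i =>
    (tsupport_mul_subset_left).trans ((hψ i).trans interior_subset)
  have hvc : ∀ i, HasCompactSupport (v i) := fun i =>
    (hC i).of_isClosed_subset (isClosed_tsupport _) (hts i)
  have hibp : ∀ i, ∫ x, v i x * laplacian g u x ∂riemannianVolume g =
      -∫ x, dirichlet g (v i) u x ∂riemannianVolume g := by
    intro i
    rw [← integral_mul_chartLaplacian g (chart_mem_atlas _ (i : M)) hu (hv i) (hvc i)
      ((hts i).trans (hCs i))]
    refine integral_congr_ae (Filter.Eventually.of_forall fun x => ?_)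
    by_cases hx : x ∈ tsupport (v i)
    · simp only [laplacian_eq_chartLaplacian g (chart_mem_atlas _ (i : M)) hu (hCs i (hts i hx))]
    · simp only [image_eq_zero_of_notMem_tsupport hx, zero_mul]
  have hlap : ∀ x, u x * laplacian g u x = ∑ i, v i x * laplacian g u x := by
    intro x
    by_cases hx : x ∈ K
    · rw [← Finset.sum_mul, hv_def]
      simp only [← Finset.sum_mul, hsum x (interior_subset (hKK' hx)), one_mul]
    · have h0 : laplacian g u x = 0 :=
        chartLaplacian_eq_zero_of_eventuallyEq_const (mem_chart_source _ x) (huc x hx)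
      simp [h0]
  have hdir : ∀ x, dirichlet g u u x = ∑ i, dirichlet g (v i) u x := by
    intro x
    obtain ⟨e, he, y, hy, rfl⟩ := exists_chart_point (n := n) x
    have hud : MDifferentiableAt (𝓡 n) 𝓘(ℝ, ℝ) u (e.symm y) :=
      hu.mdifferentiable (by norm_num) _
    have hvd : ∀ i, MDifferentiableAt (𝓡 n) 𝓘(ℝ, ℝ) (v i) (e.symm y) := fun i =>
      (hv i).mdifferentiable (by norm_num) _
    rw [dirichlet_comp_symm he hy hud hud,
      Finset.sum_congr rfl fun i _ => dirichlet_comp_symm he hy hud (hvd i), Finset.sum_comm]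
    refine Finset.sum_congr rfl fun k _ => ?_
    rw [← Finset.sum_mul]
    -- Near a point of `K` the pieces sum to `u`; off `K` the gradient of `u` vanishes, so their sum
    -- does not matter.
    by_cases hx : e.symm y ∈ K
    · congr 1
      rw [← Coord.pd_sum k _ fun i _ => ((contDiffOn_comp_symm he (by decide) (hv i)).contDiffAt
        (e.open_target.mem_nhds hy)).differentiableAt (by norm_num)]
      refine Coord.pd_congr k ?_
      filter_upwards [(e.continuousAt_symm hy).preimage_mem_nhds
        (isOpen_interior.mem_nhds (hKK' hx))] with z hz
      simp only [Function.comp_apply, hv_def, ← Finset.sum_mul, hsum _ (interior_subset hz),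
        one_mul]
    · have h1 : u ∘ e.symm =ᶠ[𝓝 y] fun _ => c :=
        (e.continuousAt_symm hy).eventually (huc _ hx)
      have h2 : ∀ l, Coord.pd l (u ∘ e.symm) y = 0 := fun l => by
        rw [Coord.pd_congr l h1, Coord.pd_const]
      simp [Coord.grad, h2]
  have hi1 : ∀ i, Integrable (fun x => v i x * laplacian g u x) (riemannianVolume g) := fun i =>
    ((hv i).continuous.mul (continuous_laplacian g hu)).integrable_of_hasCompactSupport
      ((hvc i).mul_right)
  have hi2 : ∀ i, Integrable (dirichlet g (v i) u) (riemannianVolume g) := fun i =>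
    (continuous_dirichlet g hu (hv i)).integrable_of_hasCompactSupport
      (HasCompactSupport.of_support_subset_isCompact (hvc i) fun x hx => by
        by_contra hxs
        exact hx (dirichlet_eq_zero_of_eventuallyEq_const
          (notMem_tsupport_iff_eventuallyEq.1 hxs)))
  simp only [hlap, hdir]
  rw [integral_finsetSum _ fun i _ => hi1 i, integral_finsetSum _ fun i _ => hi2 i]
  simp only [hibp, Finset.sum_neg_distrib]

/-! ### The scalar curvature of a conformal metric -/

/-- Both curvatures and the Laplacian at `x` are computed in the preferred chart at `x`, so the
coordinate formula applies directly. -/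
theorem scalarCurvature_conformal (hn : 3 ≤ n) (g : C2Metric n M)
    (hu : ContMDiff (𝓡 n) 𝓘(ℝ, ℝ) 2 u) (hpos : ∀ x, 0 < u x) (x : M) :
    scalarCurvature (g.conformal u hu hpos (4 / ((n : ℝ) - 2))) x =
      (u x ^ (4 / ((n : ℝ) - 2)))⁻¹ * (scalarCurvature g x -
        4 * (n - 1) / (n - 2) * (laplacian g u x / u x)) := by
  set e := chartAt (EuclideanSpace ℝ (Fin n)) x
  have he : e ∈ atlas (EuclideanSpace ℝ (Fin n)) M := chart_mem_atlas _ x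
  have hcoeff : metricCoeff (g.conformal u hu hpos (4 / ((n : ℝ) - 2))) e =
      fun y => (u ∘ e.symm) y ^ (4 / ((n : ℝ) - 2)) • metricCoeff g e y := by
    ext y i j; rfl
  have h := (metricOn_metricCoeff g he).scalar_rpow_conformal hn (v := u ∘ e.symm)
    (contDiffOn_comp_symm he (by decide) hu) (fun z _ => hpos _) (mem_chart_target _ x)
  have hx : (u ∘ e.symm) (e x) = u x := congrArg u (e.left_inv (mem_chart_source _ x))
  rw [← hcoeff, hx] at h
  exact h

end Manifold

/-! ### Integrals with values in the extended reals -/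

section Integral

variable {α : Type*} [MeasurableSpace α] {μ : Measure α} {f h w ρ : α → ℝ}

/-- The integral is squeezed between (1-ε)I and (1+ε)I, and both bounds tend to I even if I is
infinite, since their factors tend to 1 ≠ 0. The factors are finite constants, so no measurability
of `f` is needed to take them out. -/
theorem tendsto_lintegral_ofReal_mul {w : ℕ → α → ℝ} (hw0 : ∀ i x, 0 ≤ w i x)
    (hw : ∀ ε : ℝ, 0 < ε → ∀ᶠ i in atTop, ∀ x, |w i x - 1| ≤ ε) (f : α → ℝ) :
    Tendsto (fun i => ∫⁻ x, ENNReal.ofReal (w i x * f x) ∂μ) atTop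
      (𝓝 (∫⁻ x, ENNReal.ofReal (f x) ∂μ)) := by
  set I := ∫⁻ x, ENNReal.ofReal (f x) ∂μ with hI
  have hmul : ∀ i x, ENNReal.ofReal (w i x * f x) =
      ENNReal.ofReal (w i x) * ENNReal.ofReal (f x) := fun i x =>
    ENNReal.ofReal_mul (hw0 i x)
  have hlim : ∀ s : ℝ, Tendsto (fun ε : ℝ => ENNReal.ofReal (1 + s * ε) * I) (𝓝[>] 0) (𝓝 I) := by
    intro s
    have h1 : Tendsto (fun ε : ℝ => ENNReal.ofReal (1 + s * ε)) (𝓝[>] 0) (𝓝 1) := by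
      have : Continuous fun ε : ℝ => ENNReal.ofReal (1 + s * ε) :=
        ENNReal.continuous_ofReal.comp (by fun_prop)
      have h2 := (this.tendsto 0).mono_left (nhdsWithin_le_nhds (s := Set.Ioi 0))
      simpa using h2
    simpa using ENNReal.Tendsto.mul_const (b := I) h1 (Or.inl one_ne_zero)
  refine tendsto_order.2 ⟨fun a ha => ?_, fun a ha => ?_⟩
  · obtain ⟨ε, hε, hε0⟩ := (((tendsto_order.1 (hlim (-1))).1 a ha).and self_mem_nhdsWithin).exists
    filter_upwards [hw ε hε0] with i hi
    refine hε.trans_le ?_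
    rw [hI, ← lintegral_const_mul' _ _ ENNReal.ofReal_ne_top]
    refine lintegral_mono fun x => ?_
    rw [hmul]
    gcongr
    linarith [(abs_le.1 (hi x)).1]
  · obtain ⟨ε, hε, hε0⟩ := (((tendsto_order.1 (hlim 1)).2 a ha).and self_mem_nhdsWithin).exists
    filter_upwards [hw ε hε0] with i hi
    refine lt_of_le_of_lt ?_ hε
    rw [hI, ← lintegral_const_mul' _ _ ENNReal.ofReal_ne_top]
    refine lintegral_mono fun x => ?_
    rw [hmul]
    gcongr
    linarith [(abs_le.1 (hi x)).2]

theorem lintegral_ofReal_mul_ne_top {C : ℝ} (hw0 : ∀ x, 0 ≤ w x) (hwC : ∀ x, w x ≤ C)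
    (hf : ∫⁻ x, ENNReal.ofReal (f x) ∂μ ≠ ⊤) : ∫⁻ x, ENNReal.ofReal (w x * f x) ∂μ ≠ ⊤ := by
  refine ne_top_of_le_ne_top (ENNReal.mul_ne_top (ENNReal.ofReal_ne_top (r := C)) hf) ?_
  rw [← lintegral_const_mul' _ _ ENNReal.ofReal_ne_top]
  refine lintegral_mono fun x => ?_
  rw [ENNReal.ofReal_mul (hw0 x)]
  gcongr
  exact hwC x

theorem HasExtIntegral.mul {C : ℝ} (hf : HasExtIntegral f μ) (hw : Measurable w)
    (hw0 : ∀ x, 0 ≤ w x) (hwC : ∀ x, w x ≤ C) : HasExtIntegral (fun x => w x * f x) μ := by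
  refine ⟨hw.aemeasurable.mul hf.1, hf.2.imp (lintegral_ofReal_mul_ne_top hw0 hwC) fun h => ?_⟩
  simp only [← mul_neg]
  exact lintegral_ofReal_mul_ne_top (f := fun x => -f x) hw0 hwC h

theorem lintegral_ofReal_add_le (hf : AEMeasurable f μ) :
    ∫⁻ x, ENNReal.ofReal (f x + h x) ∂μ ≤
      ∫⁻ x, ENNReal.ofReal (f x) ∂μ + ∫⁻ x, ENNReal.ofReal (h x) ∂μ := by
  rw [← lintegral_add_left' hf.ennreal_ofReal]
  exact lintegral_mono fun x => ENNReal.ofReal_add_le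

theorem MeasureTheory.Integrable.lintegral_ofReal_ne_top (hh : Integrable h μ) :
    ∫⁻ x, ENNReal.ofReal (h x) ∂μ ≠ ⊤ := hh.lintegral_lt_top.ne

theorem HasExtIntegral.add (hf : HasExtIntegral f μ) (hh : Integrable h μ) :
    HasExtIntegral (fun x => f x + h x) μ := by
  refine ⟨hf.1.add hh.aemeasurable, hf.2.imp (fun hA => ?_) fun hB => ?_⟩
  · exact ne_top_of_le_ne_top (ENNReal.add_ne_top.2 ⟨hA, hh.lintegral_ofReal_ne_top⟩)
      (lintegral_ofReal_add_le hf.1)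
  · simp only [neg_add]
    exact ne_top_of_le_ne_top (ENNReal.add_ne_top.2 ⟨hB, hh.neg.lintegral_ofReal_ne_top⟩)
      (lintegral_ofReal_add_le hf.1.neg)

/-- Here `A`, `B` stand for the integrals of f⁺, f⁻, then `P`, `N` for those of h and `A'`, `B'` for
those of f + h. The balance is stated without subtraction, so it also makes sense for infinite
values; it forces `A'` or `B'` to be infinite together with `A` or `B`. -/
theorem EReal.coe_ennreal_sub_eq_of_add_eq {A B A' B' P N : ENNReal} (hAB : A ≠ ⊤ ∨ B ≠ ⊤)
    (hP : P ≠ ⊤) (hN : N ≠ ⊤) (hA'le : A' ≤ A + P) (hB'le : B' ≤ B + N)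
    (hbal : A' + B + N = B' + A + P) :
    (A' : EReal) - B' = (A : EReal) - B + ((P.toReal - N.toReal : ℝ) : EReal) := by
  by_cases hA : A = ⊤
  · have hB : B ≠ ⊤ := hAB.resolve_left (not_not.2 hA)
    have hB' : B' ≠ ⊤ := ne_top_of_le_ne_top (ENNReal.add_ne_top.2 ⟨hB, hN⟩) hB'le
    have hA' : A' = ⊤ := by
      by_contra hne
      rw [hA, add_top, top_add] at hbal
      exact (ENNReal.add_ne_top.2 ⟨ENNReal.add_ne_top.2 ⟨hne, hB⟩, hN⟩) hbal
    rw [hA, hA', EReal.coe_ennreal_top, EReal.top_sub (by simpa using hB'),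
      EReal.top_sub (by simpa using hB), EReal.top_add_coe]
  · have hA' : A' ≠ ⊤ := ne_top_of_le_ne_top (ENNReal.add_ne_top.2 ⟨hA, hP⟩) hA'le
    by_cases hB : B = ⊤
    · have hB' : B' = ⊤ := by
        by_contra hne
        rw [hB, add_top, top_add] at hbal
        exact (ENNReal.add_ne_top.2 ⟨ENNReal.add_ne_top.2 ⟨hne, hA⟩, hP⟩) hbal.symm
      rw [hB, hB', EReal.coe_ennreal_top, EReal.sub_top, EReal.sub_top, EReal.bot_add]
    · have hB' : B' ≠ ⊤ := ne_top_of_le_ne_top (ENNReal.add_ne_top.2 ⟨hB, hN⟩) hB'le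
      have h := congrArg ENNReal.toReal hbal
      rw [ENNReal.toReal_add (ENNReal.add_ne_top.2 ⟨hA', hB⟩) hN, ENNReal.toReal_add hA' hB,
        ENNReal.toReal_add (ENNReal.add_ne_top.2 ⟨hB', hA⟩) hP, ENNReal.toReal_add hB' hA] at h
      rw [← EReal.coe_ennreal_toReal hA, ← EReal.coe_ennreal_toReal hB,
        ← EReal.coe_ennreal_toReal hA', ← EReal.coe_ennreal_toReal hB', ← EReal.coe_sub,
        ← EReal.coe_sub, ← EReal.coe_add, EReal.coe_eq_coe_iff]
      linarith

theorem extIntegral_add (hf : HasExtIntegral f μ) (hh : Integrable h μ) :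
    extIntegral (fun x => f x + h x) μ = extIntegral f μ + ((∫ x, h x ∂μ : ℝ) : EReal) := by
  have hA'le : ∫⁻ x, ENNReal.ofReal (f x + h x) ∂μ ≤ _ := lintegral_ofReal_add_le (h := h) hf.1
  have hB'le : ∫⁻ x, ENNReal.ofReal (-f x + -h x) ∂μ ≤ _ :=
    lintegral_ofReal_add_le (h := fun x => -h x) hf.1.neg
  have hP := hh.lintegral_ofReal_ne_top
  have hN : ∫⁻ x, ENNReal.ofReal (-h x) ∂μ ≠ ⊤ := hh.neg.lintegral_ofReal_ne_top
  -- This is the integral of the pointwise identity (f+h)⁺ + f⁻ + h⁻ = (f+h)⁻ + f⁺ + h⁺.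
  have hbal : ∫⁻ x, ENNReal.ofReal (f x + h x) ∂μ + ∫⁻ x, ENNReal.ofReal (-f x) ∂μ +
      ∫⁻ x, ENNReal.ofReal (-h x) ∂μ = ∫⁻ x, ENNReal.ofReal (-f x + -h x) ∂μ +
      ∫⁻ x, ENNReal.ofReal (f x) ∂μ + ∫⁻ x, ENNReal.ofReal (h x) ∂μ := by
    have m1 := (hf.1.add hh.aemeasurable).ennreal_ofReal
    have m2 := hf.1.neg.ennreal_ofReal
    have m3 := hf.1.ennreal_ofReal
    have m4 := (hf.1.neg.add hh.aemeasurable.neg).ennreal_ofReal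
    have e1 := lintegral_add_left' m1 fun x => ENNReal.ofReal (-f x)
    have e2 := lintegral_add_left' (m1.add m2) fun x => ENNReal.ofReal (-h x)
    have e3 := lintegral_add_left' m4 fun x => ENNReal.ofReal (f x)
    have e4 := lintegral_add_left' (m4.add m3) fun x => ENNReal.ofReal (h x)
    simp only [Pi.add_apply, Pi.neg_apply] at e1 e2 e3 e4
    rw [← e1, ← e2, ← e3, ← e4]
    refine lintegral_congr fun x => ?_
    have key : ∀ a b : ℝ, max (a + b) 0 + max (-a) 0 + max (-b) 0 =
        max (-a + -b) 0 + max a 0 + max b 0 := by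
      intro a b
      have := max_zero_sub_eq_self a
      have h1 := max_zero_sub_eq_self b
      have h2 := max_zero_sub_eq_self (a + b)
      rw [neg_add] at h2
      linarith
    have hr : ∀ r : ℝ, ENNReal.ofReal r = ENNReal.ofReal (max r 0) := fun r => by simp
    rw [hr (f x + h x), hr (-f x), hr (-h x), hr (-f x + -h x), hr (f x), hr (h x),
      ← ENNReal.ofReal_add (by positivity) (by positivity),
      ← ENNReal.ofReal_add (by positivity) (by positivity),
      ← ENNReal.ofReal_add (by positivity) (by positivity),
      ← ENNReal.ofReal_add (by positivity) (by positivity), key]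
  have hint : ∫ x, h x ∂μ = (∫⁻ x, ENNReal.ofReal (h x) ∂μ).toReal -
      (∫⁻ x, ENNReal.ofReal (-h x) ∂μ).toReal :=
    integral_eq_lintegral_pos_part_sub_lintegral_neg_part hh
  have hcases := hf.2
  simp only [extIntegral, neg_add]
  rw [hint]
  exact EReal.coe_ennreal_sub_eq_of_add_eq hcases hP hN hA'le hB'le hbal

theorem integrable_iff_lintegral_ofReal_ne_top : Integrable f μ ↔ AEMeasurable f μ ∧
    ∫⁻ x, ENNReal.ofReal (f x) ∂μ ≠ ⊤ ∧ ∫⁻ x, ENNReal.ofReal (-f x) ∂μ ≠ ⊤ := by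
  refine ⟨fun hf => ⟨hf.aemeasurable, hf.lintegral_ofReal_ne_top, hf.neg.lintegral_ofReal_ne_top⟩,
    fun ⟨hm, hA, hB⟩ => ⟨hm.aestronglyMeasurable, ?_⟩⟩
  rw [hasFiniteIntegral_iff_norm]
  refine lt_of_le_of_lt ?_ (ENNReal.add_ne_top.2 ⟨hA, hB⟩).lt_top
  rw [← lintegral_add_left' hm.ennreal_ofReal]
  refine lintegral_mono fun x => ?_
  rcases le_total 0 (f x) with h0 | h0
  · rw [Real.norm_of_nonneg h0]; exact le_self_add
  · rw [Real.norm_of_nonpos h0]; exact le_add_self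

theorem MeasureTheory.Integrable.hasExtIntegral (hf : Integrable f μ) : HasExtIntegral f μ :=
  ⟨hf.aemeasurable, Or.inl hf.lintegral_ofReal_ne_top⟩

theorem MeasureTheory.Integrable.extIntegral_eq (hf : Integrable f μ) :
    extIntegral f μ = ((∫ x, f x ∂μ : ℝ) : EReal) := by
  have hA := hf.lintegral_ofReal_ne_top
  have hB : ∫⁻ x, ENNReal.ofReal (-f x) ∂μ ≠ ⊤ := hf.neg.lintegral_ofReal_ne_top
  rw [extIntegral, integral_eq_lintegral_pos_part_sub_lintegral_neg_part hf, EReal.coe_sub,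
    EReal.coe_ennreal_toReal hA, EReal.coe_ennreal_toReal hB]

theorem tendsto_extIntegral_mul {w : ℕ → α → ℝ} (hw0 : ∀ i x, 0 ≤ w i x)
    (hw : ∀ ε : ℝ, 0 < ε → ∀ᶠ i in atTop, ∀ x, |w i x - 1| ≤ ε) (hf : HasExtIntegral f μ) :
    Tendsto (fun i => extIntegral (fun x => w i x * f x) μ) atTop (𝓝 (extIntegral f μ)) := by
  have hA := tendsto_lintegral_ofReal_mul (μ := μ) hw0 hw f
  have hB := tendsto_lintegral_ofReal_mul (μ := μ) hw0 hw fun x => -f x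
  simp only [mul_neg] at hB
  have hA' := (continuous_coe_ennreal_ereal.tendsto _).comp hA
  have hB' := (continuous_neg.tendsto _).comp ((continuous_coe_ennreal_ereal.tendsto _).comp hB)
  -- Addition in `EReal` is discontinuous only where opposite infinities meet, which the existence
  -- of the extended integral excludes.
  have hadd := EReal.continuousAt_add
    (p := (((∫⁻ x, ENNReal.ofReal (f x) ∂μ : ENNReal) : EReal),
      -((∫⁻ x, ENNReal.ofReal (-f x) ∂μ : ENNReal) : EReal)))
    (by simpa using hf.2) (Or.inl (EReal.coe_ennreal_ne_bot _))
  simpa only [extIntegral, sub_eq_add_neg, Function.comp_def] using hadd.tendsto.comp (hA'.prodMk_nhds hB')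

theorem lintegral_ofReal_withDensity (hρ : Measurable ρ) (hρ0 : ∀ x, 0 < ρ x) (F : α → ℝ) :
    ∫⁻ x, ENNReal.ofReal (F x) ∂μ.withDensity (fun x => ENNReal.ofReal (ρ x)) =
      ∫⁻ x, ENNReal.ofReal (ρ x * F x) ∂μ := by
  rw [lintegral_withDensity_eq_lintegral_mul_non_measurable _ hρ.ennreal_ofReal
    (Filter.Eventually.of_forall fun _ => ENNReal.ofReal_lt_top)]
  exact lintegral_congr fun x => (ENNReal.ofReal_mul (hρ0 x).le).symm

theorem aemeasurable_withDensity (hρ : Measurable ρ) (hρ0 : ∀ x, 0 < ρ x) {F : α → ℝ}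
    (hF : AEMeasurable (fun x => ρ x * F x) μ) :
    AEMeasurable F (μ.withDensity fun x => ENNReal.ofReal (ρ x)) := by
  have : AEMeasurable (fun x => (ρ x)⁻¹ * (ρ x * F x)) μ := hρ.inv.aemeasurable.mul hF
  refine (this.congr (Filter.Eventually.of_forall fun x => ?_)).mono_ac
    (withDensity_absolutelyContinuous _ _)
  exact inv_mul_cancel_left₀ (hρ0 x).ne' _

theorem extIntegral_withDensity (hρ : Measurable ρ) (hρ0 : ∀ x, 0 < ρ x) (F : α → ℝ) :
    extIntegral F (μ.withDensity fun x => ENNReal.ofReal (ρ x)) =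
      extIntegral (fun x => ρ x * F x) μ := by
  rw [extIntegral, lintegral_ofReal_withDensity hρ hρ0,
    lintegral_ofReal_withDensity hρ hρ0 fun x => -F x]
  simp only [mul_neg]
  rfl

theorem HasExtIntegral.withDensity (hρ : Measurable ρ) (hρ0 : ∀ x, 0 < ρ x) {F : α → ℝ}
    (hF : HasExtIntegral (fun x => ρ x * F x) μ) :
    HasExtIntegral F (μ.withDensity fun x => ENNReal.ofReal (ρ x)) := by
  refine ⟨aemeasurable_withDensity hρ hρ0 hF.1, ?_⟩
  rw [lintegral_ofReal_withDensity hρ hρ0, lintegral_ofReal_withDensity hρ hρ0 fun x => -F x]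
  simpa only [mul_neg] using hF.2

theorem integrable_withDensity_of_integrable_mul (hρ : Measurable ρ) (hρ0 : ∀ x, 0 < ρ x)
    {F : α → ℝ} (hF : Integrable (fun x => ρ x * F x) μ) :
    Integrable F (μ.withDensity fun x => ENNReal.ofReal (ρ x)) := by
  rw [integrable_iff_lintegral_ofReal_ne_top] at hF ⊢
  refine ⟨aemeasurable_withDensity hρ hρ0 hF.1, ?_⟩
  rw [lintegral_ofReal_withDensity hρ hρ0, lintegral_ofReal_withDensity hρ hρ0 fun x => -F x]
  simpa only [mul_neg] using hF.2

end Integral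

/-! ### Convergence of the total scalar curvature -/

section Main

variable {n : ℕ} {M : Type*} [TopologicalSpace M] [T2Space M] [SecondCountableTopology M]
  [ChartedSpace (EuclideanSpace ℝ (Fin n)) M] [IsManifold (𝓡 n) ∞ M] [Nonempty M]
  [MeasurableSpace M] [BorelSpace M] {g : C2Metric n M}

theorem TendstoUniformlyC1.eventually_abs_sq_sub_one_le {u : ℕ → M → ℝ}
    (hconv : TendstoUniformlyC1 g u fun _ => 1) {ε : ℝ} (hε : 0 < ε) :
    ∀ᶠ i in atTop, ∀ x, |u i x ^ 2 - 1| ≤ ε := by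
  -- The bound 1 keeps |u + 1| ≤ 3, and ε/3 absorbs that factor in |u² - 1| = |u - 1| |u + 1|.
  have hδ : 0 < min 1 (ε / 3) := by positivity
  filter_upwards [Metric.tendstoUniformly_iff.1 hconv.1 _ hδ] with i hi x
  have h := hi x
  rw [Real.dist_eq, abs_sub_comm] at h
  have h1 := h.le.trans (min_le_left _ _)
  have h2 := h.le.trans (min_le_right _ _)
  have h3 : |u i x + 1| ≤ 3 := by
    rw [abs_le] at h1 ⊢
    constructor <;> linarith
  calc |u i x ^ 2 - 1| = |u i x - 1| * |u i x + 1| := by rw [← abs_mul]; ring_nf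
    _ ≤ ε / 3 * 3 := by gcongr
    _ = ε := by ring

theorem tendsto_integral_dirichlet {u : ℕ → M → ℝ}
    (hu : ∀ i, ContMDiff (𝓡 n) 𝓘(ℝ, ℝ) 2 (u i)) {K : Set M} (hK : IsCompact K)
    (huK : ∀ i, ∀ x ∉ K, u i x = 1) (hconv : TendstoUniformlyC1 g u fun _ => 1) :
    Tendsto (fun i => ∫ x, dirichlet g (u i) (u i) x ∂riemannianVolume g) atTop (𝓝 0) := by
  have := isLocallyFiniteMeasure_riemannianVolume g
  have hKfin : riemannianVolume g K < ⊤ := hK.measure_lt_top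
  rw [Metric.tendsto_nhds]
  intro ε hε
  set m := (riemannianVolume g).real K with hm
  have hm0 : 0 ≤ m := measureReal_nonneg
  -- The energy is then at most δ² m = ε m/(m+1) < ε; the added 1 covers `m = 0`.
  set δ := √(ε / (m + 1)) with hδ_def
  have hδ : 0 < δ := by positivity
  filter_upwards [hconv.2 δ hδ] with i hi
  have hle : ∀ x ∈ K, ‖dirichlet g (u i) (u i) x‖ ≤ δ ^ 2 := by
    intro x _
    have hd : MDifferentiableAt (𝓡 n) 𝓘(ℝ, ℝ) (u i) x := (hu i).mdifferentiable (by norm_num) x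
    rw [Real.norm_of_nonneg (dirichlet_self_nonneg hd)]
    refine dirichlet_self_le hd fun w => ?_
    have h := hi x w
    have h0 : (show ℝ from mfderiv (𝓡 n) 𝓘(ℝ, ℝ) (fun _ : M => (1 : ℝ)) x w) = 0 := by
      rw [mfderiv_const]; rfl
    rwa [h0, sub_zero] at h
  rw [dist_zero_right, ← setIntegral_eq_integral_of_forall_compl_eq_zero (s := K) fun x hx =>
    dirichlet_eq_zero_of_eventuallyEq_const (c := 1)
      (Filter.eventually_of_mem (hK.isClosed.isOpen_compl.mem_nhds hx) (huK i))]
  refine (norm_setIntegral_le_of_norm_le_const hKfin hle).trans_lt ?_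
  rw [hδ_def, Real.sq_sqrt (by positivity), ← hm, div_mul_eq_mul_div, div_lt_iff₀ (by positivity)]
  nlinarith

theorem exists_bound_of_eq_one_off_compact {u : M → ℝ} (hu : Continuous u) {K : Set M}
    (hK : IsCompact K) (huK : ∀ x ∉ K, u x = 1) : ∃ C, ∀ x, u x ^ 2 ≤ C := by
  obtain ⟨C, hC⟩ := (hK.image (hu.pow 2)).bddAbove
  refine ⟨max C 1, fun x => ?_⟩
  by_cases hx : x ∈ K
  · exact (hC ⟨x, hx, rfl⟩).trans (le_max_left _ _)
  · rw [huK x hx, one_pow]; exact le_max_right _ _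

/-- The volume exponent 2n/(n-2) equals 2 + 4/(n-2). Its second part cancels the factor in the
conformal law, and the remaining u² multiplies Δu/u to u Δu. -/
theorem rpow_mul_scalarCurvature_conformal (hn : 3 ≤ n) {u : M → ℝ}
    (hu : ContMDiff (𝓡 n) 𝓘(ℝ, ℝ) 2 u) (hpos : ∀ x, 0 < u x) (x : M) :
    u x ^ (4 / ((n : ℝ) - 2) * n / 2) *
      scalarCurvature (g.conformal u hu hpos (4 / ((n : ℝ) - 2))) x =
      u x ^ 2 * scalarCurvature g x + -(4 * (n - 1) / (n - 2)) * (u x * laplacian g u x) := by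
  have hn2 : (n : ℝ) - 2 ≠ 0 := by
    have : (3 : ℝ) ≤ n := by exact_mod_cast hn
    linarith
  have hux := hpos x
  have hexp : u x ^ (4 / ((n : ℝ) - 2) * n / 2) = u x ^ 2 * u x ^ (4 / ((n : ℝ) - 2)) := by
    rw [← Real.rpow_natCast, ← Real.rpow_add hux]
    congr 1
    push_cast
    field_simp
    ring
  have hne : u x ^ (4 / ((n : ℝ) - 2)) ≠ 0 := (Real.rpow_pos_of_pos hux _).ne'
  rw [scalarCurvature_conformal hn, hexp, mul_assoc, mul_inv_cancel_left₀ hne]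
  field_simp
  ring

theorem integrable_mul_laplacian (g : C2Metric n M) {u : M → ℝ}
    (hu : ContMDiff (𝓡 n) 𝓘(ℝ, ℝ) 2 u) {K : Set M} (hK : IsCompact K) {c : ℝ}
    (huK : ∀ x ∉ K, u x = c) :
    Integrable (fun x => u x * laplacian g u x) (riemannianVolume g) := by
  have := isLocallyFiniteMeasure_riemannianVolume g
  refine (hu.continuous.mul (continuous_laplacian g hu)).integrable_of_hasCompactSupport
    (HasCompactSupport.of_support_subset_isCompact hK fun x hx => ?_)
  by_contra hxK
  exact hx (mul_eq_zero_of_right _ (chartLaplacian_eq_zero_of_eventuallyEq_const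
    (mem_chart_source _ x)
    (Filter.eventually_of_mem (hK.isClosed.isOpen_compl.mem_nhds hxK) huK)))

end Main

end

theorem mainTheorem5 (n : ℕ) (hn : 3 ≤ n)
    (M : Type*) [TopologicalSpace M] [T2Space M] [SecondCountableTopology M]
    [ChartedSpace (EuclideanSpace ℝ (Fin n)) M] [IsManifold (𝓡 n) ∞ M]
    [Nonempty M] [NoncompactSpace M] [MeasurableSpace M] [BorelSpace M]
    (g : C2Metric n M) (u : ℕ → M → ℝ)
    (hu : ∀ i, ContMDiff (𝓡 n) 𝓘(ℝ, ℝ) 2 (u i)) (hpos : ∀ i x, 0 < u i x)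
    (hsupp : ∃ K : Set M, IsCompact K ∧ ∀ i, ∀ x ∉ K, u i x = 1)
    (hconv : TendstoUniformlyC1 g u (fun _ => 1))
    (gi : ℕ → C2Metric n M)
    (hgi : ∀ i, gi i = g.conformal (u i) (hu i) (hpos i) (4 / ((n : ℝ) - 2))) :
    (HasExtIntegral (scalarCurvature g) (riemannianVolume g) →
      (∀ i, HasExtIntegral (scalarCurvature (gi i)) (riemannianVolume (gi i))) ∧
      Tendsto (fun i => extIntegral (scalarCurvature (gi i)) (riemannianVolume (gi i))) atTop
        (𝓝 (extIntegral (scalarCurvature g) (riemannianVolume g)))) ∧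
    (Integrable (scalarCurvature g) (riemannianVolume g) →
      (∀ i, Integrable (scalarCurvature (gi i)) (riemannianVolume (gi i))) ∧
      Tendsto (fun i => ∫ x, scalarCurvature (gi i) x ∂(riemannianVolume (gi i))) atTop
        (𝓝 (∫ x, scalarCurvature g x ∂(riemannianVolume g)))) := by
  obtain ⟨K, hK, huK⟩ := hsupp
  set μ := riemannianVolume g with hμ
  set f := scalarCurvature g with hf_def
  set a : ℝ := -(4 * (n - 1) / (n - 2)) with ha
  set ρ : ℕ → M → ℝ := fun i x => u i x ^ (4 / ((n : ℝ) - 2) * n / 2) with hρ_def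
  have hρ : ∀ i, Measurable (ρ i) := fun i => (hu i).continuous.measurable.pow_const _
  have hρ0 : ∀ i x, 0 < ρ i x := fun i x => Real.rpow_pos_of_pos (hpos i x) _
  have hvol : ∀ i, riemannianVolume (gi i) = μ.withDensity fun x => ENNReal.ofReal (ρ i x) :=
    fun i => by rw [hgi i]; exact riemannianVolume_conformal g (hu i) (hpos i) _
  have hcurv : ∀ i, (fun x => ρ i x * scalarCurvature (gi i) x) =
      fun x => u i x ^ 2 * f x + a * (u i x * laplacian g (u i) x) := fun i => by
    ext x
    rw [hgi i]
    exact rpow_mul_scalarCurvature_conformal hn (hu i) (hpos i) x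
  have hE : ∀ i, Integrable (fun x => a * (u i x * laplacian g (u i) x)) μ := fun i =>
    (integrable_mul_laplacian g (hu i) hK (huK i)).const_mul a
  -- Green's formula replaces an integral containing second derivatives, which the hypotheses do not
  -- control in the limit, by the Dirichlet energy, which they do.
  have hElim : Tendsto (fun i => ∫ x, a * (u i x * laplacian g (u i) x) ∂μ) atTop (𝓝 0) := by
    have h := (tendsto_integral_dirichlet hu hK huK hconv).const_mul (-a)
    rw [mul_zero] at h
    refine h.congr fun i => ?_
    rw [integral_const_mul, integral_mul_laplacian g (hu i) hK (huK i)]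
    ring
  have hbound : ∀ i, ∃ C, ∀ x, u i x ^ 2 ≤ C := fun i =>
    exists_bound_of_eq_one_off_compact (hu i).continuous hK (huK i)
  have hsqm : ∀ i, Measurable fun x => u i x ^ 2 := fun i => ((hu i).continuous.pow 2).measurable
  have hsq : ∀ i, HasExtIntegral f μ → HasExtIntegral (fun x => u i x ^ 2 * f x) μ := by
    intro i hf
    obtain ⟨C, hC⟩ := hbound i
    exact hf.mul (hsqm i) (fun x => sq_nonneg _) hC
  have hext : HasExtIntegral f μ →
      (∀ i, HasExtIntegral (scalarCurvature (gi i)) (riemannianVolume (gi i))) ∧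
      Tendsto (fun i => extIntegral (scalarCurvature (gi i)) (riemannianVolume (gi i))) atTop
        (𝓝 (extIntegral f μ)) := by
    intro hf
    refine ⟨fun i => ?_, ?_⟩
    · rw [hvol i]
      refine HasExtIntegral.withDensity (hρ i) (hρ0 i) ?_
      rw [hcurv i]
      exact (hsq i hf).add (hE i)
    · have h1 : ∀ i, extIntegral (scalarCurvature (gi i)) (riemannianVolume (gi i)) =
          extIntegral (fun x => u i x ^ 2 * f x) μ +
            ((∫ x, a * (u i x * laplacian g (u i) x) ∂μ : ℝ) : EReal) := fun i => by
        rw [hvol i, extIntegral_withDensity (hρ i) (hρ0 i), hcurv i,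
          extIntegral_add (hsq i hf) (hE i)]
      simp only [h1]
      have h2 := tendsto_extIntegral_mul (w := fun i x => u i x ^ 2) (fun i x => sq_nonneg _)
        (fun ε hε => hconv.eventually_abs_sq_sub_one_le hε) hf
      have h3 : Tendsto (fun i => ((∫ x, a * (u i x * laplacian g (u i) x) ∂μ : ℝ) : EReal)) atTop
          (𝓝 ((0 : ℝ) : EReal)) := (continuous_coe_real_ereal.tendsto 0).comp hElim
      -- The second summand has a finite limit, so addition is continuous there even if the first
      -- limit is infinite.
      have h4 := (EReal.continuousAt_add (p := (extIntegral f μ, ((0 : ℝ) : EReal)))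
        (Or.inr (EReal.coe_ne_bot 0)) (Or.inr (EReal.coe_ne_top 0))).tendsto.comp
        (h2.prodMk_nhds h3)
      simpa only [EReal.coe_zero, add_zero, Function.comp_def] using h4
  refine ⟨hext, fun hf => ?_⟩
  have hint : ∀ i, Integrable (scalarCurvature (gi i)) (riemannianVolume (gi i)) := by
    intro i
    obtain ⟨C, hC⟩ := hbound i
    rw [hvol i]
    refine integrable_withDensity_of_integrable_mul (hρ i) (hρ0 i) ?_
    rw [hcurv i]
    refine (hf.bdd_mul (c := C) (hsqm i).aestronglyMeasurable
      (Filter.Eventually.of_forall fun x => ?_)).add (hE i)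
    rw [Real.norm_of_nonneg (sq_nonneg _)]
    exact hC x
  refine ⟨hint, ?_⟩
  -- For integrable functions the extended integrals are real, and the reals embed topologically in
  -- `EReal`.
  have h := (hext hf.hasExtIntegral).2
  simp only [hf.extIntegral_eq, fun i => (hint i).extIntegral_eq] at h
  exact EReal.tendsto_coe.1 h
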